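/- **Setting.** Let $\mathcal X\subset\mathbb R^d$ be compact, $\sigma>0$, $\alpha\in(0,1]$, $\delta>0$, and let $0<\theta^L_i\le\theta^U_i$ for $i=1,\dots,d$. For a lengthscale vector $\theta$ let $k^\theta(x,x')=\exp\bigl(-\tfrac12\sum_i (x_i-x_i')^2/\theta_i^2\bigr)$ be the squared exponential kernel. Let $f:\mathcal X\to\mathbb R$ belong to the reproducing kernel Hilbert space $\mathcal H_{\theta^U}$ of $k^{\theta^U}$ on $\mathcal X$, with maximizer $x^\star$. In round $t=1,2,\dots$ a point $x_t\in\mathcal X$ is queried and $y_t=f(x_t)+\varepsilon_t$ is observed; $x_t$ is measurable with respect to the past $\mathcal F_{t-1}$, and $\varepsilon_t\sim\mathcal N(0,\sigma^2)$ is $\mathcal F_t$-measurable and independent of $\mathcal F_{t-1}$. With $K^\theta_n=[k^\theta(x_i,x_j)]_{i,j\le n}$ and $k^\theta_n(x)=(k^\theta(x_i,x))_{i\le n}$, the $\alpha$-tempered Gaussian process posterior after $n$ observations has mean and variance $$\mu_{n,\alpha}(x;\theta)=k^\theta_n(x)^\top\bigl(K^\theta_n+\tfrac{\sigma^2}{\alpha}I\bigr)^{-1}y_{1:n},\qquad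 \sigma^2_{n,\alpha}(x;\theta)=k^\theta(x,x)-k^\theta_n(x)^\top\bigl(K^\theta_n+\tfrac{\sigma^2}{\alpha}I\bigr)^{-1}k^\theta_n(x).$$ For $g\ge1$ let $\tau_g(v)=\int_v^\infty (u-v)^g\phi(u)\,du$, with $\phi$ the standard normal density. In round $t$, with lengthscales $\theta_t$ satisfying $\theta^L\le\theta_t\le\theta^U$ coordinatewise (they may depend on the data) and a rescaling $\nu_t>0$, the point $x_t$ maximizes over $x\in\mathcal X$ the rescaled $g$-EI acquisition function $$\nu_t^g\,\sigma_{t-1,\alpha}(x;\theta_t)^g\,\tau_g\!\left(\frac{\max_{z\in\mathcal X}\mu_{t-1,\alpha}(z;\theta_t)-\mu_{t-1,\alpha}(x;\theta_t)}{\nu_t\,\sigma_{t-1,\alpha}(x;\theta_t)}\right).$$ Let $\gamma^\theta_{t,\alpha}=\max\tfrac12\log\det\bigl(I+\alpha\sigma^{-2}[k^\theta(a_i,a_j)]_{i,j\le t}\bigr)$, the maximum over all $a_1,\dots,a_t\in\mathcal X$, not necessarily distinct, and let $$m^\theta_{\alpha,t}=\sqrt\alpha\left(\sqrt{\gamma^\theta_{t-1,\alpha}}+\sqrt{\log\tfrac{2t^2\pi^2}{3\delta}}\right).$$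 Assume that $\nu_t$ is of the same order as $m^{\theta_t}_{\alpha,t}$: for a constant $C_1>0$ and all $t\ge1$, $|m^{\theta_t}_{\alpha,t}/\nu_t|\le C_1$ and $\nu_t\le C_1m^{\theta_t}_{\alpha,t}$. Put $C_2=\prod_{i=1}^d\theta^U_i/\theta^L_i$ and $C_{(g)}=\dfrac{2^{g/2}\,\Gamma((g+1)/2)}{2\sqrt\pi}$. **Theorem.** For every $g\ge1$, $\tau_g$ is strictly decreasing from $\mathbb R$ onto $(0,\infty)$, so that its inverse $\tau_g^{-1}$ is well defined. Moreover there are a constant $K>0$ depending only on $\sigma$ and, for each $B\ge0$, a constant $C_3>0$ depending only on $\sigma,d,\mathcal X,\theta^L,\theta^U,\alpha,\delta,C_1$ and $B$ (not on $g$, on $T$ or on the run of the algorithm), such that whenever $\|f\|_{\mathcal H_{\theta^U}}\le B$, with probability at least $1-\delta$ the cumulative regret $R_T=\sum_{t=1}^T\bigl(f(x^\star)-f(x_t)\bigr)$ satisfies, simultaneously for all $T\ge1$, $$R_T\le K\,\beta_{T,\alpha,g}\sqrt{\gamma^{\theta^L}_{T,\alpha}\,T/\alpha},$$ $$\beta_{T,\alpha,g}=\sqrt{2C_2}\,\|f\|_{\mathcal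 H_{\theta^U}}+\left[C_1C_3C_{(g)}^{1/g}+2\sqrt2+C_1\tau_g^{-1}\!\left(C_{(g)}\Bigl(\frac{\sigma^2}{\alpha(T-1)+\sigma^2}\Bigr)^{g/2}\right)\right]m^{\theta^L}_{\alpha,T}.$$ -/

import Mathlib

open MeasureTheory ProbabilityTheory
open scoped Matrix

noncomputable section

namespace TemperedBO

/-- Euclidean space `ℝ^d`, in which the search domain lives. -/
abbrev E (d : ℕ) : Type := EuclideanSpace ℝ (Fin d)

/-- Squared exponential kernel with lengthscale vector `ℓ`:
`k(x, x') = exp (-(1/2) (x - x')ᵀ diag(ℓ²)⁻¹ (x - x'))`. -/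
def seKernel {d : ℕ} (ℓ : Fin d → ℝ) (x x' : E d) : ℝ :=
  Real.exp (-(1 / 2) * ∑ i, (x i - x' i) ^ 2 / ℓ i ^ 2)

/-- Kernel matrix of a finite tuple of points. -/
def gram {d n : ℕ} (ℓ : Fin d → ℝ) (p : Fin n → E d) : Matrix (Fin n) (Fin n) ℝ :=
  Matrix.of fun i j => seKernel ℓ (p i) (p j)

/-- The vector `(k(p₁, z), …, k(pₙ, z))`. -/
def kvec {d n : ℕ} (ℓ : Fin d → ℝ) (p : Fin n → E d) (z : E d) : Fin n → ℝ :=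
  fun i => seKernel ℓ (p i) z

/-- Mean at `z` of the `α`-tempered Gaussian process posterior given the design points `p` and the
observations `y`: `k(z)ᵀ (K + (σ²/α) I)⁻¹ y`. -/
def postMean {d n : ℕ} (σ α : ℝ) (ℓ : Fin d → ℝ) (p : Fin n → E d) (y : Fin n → ℝ) (z : E d) : ℝ :=
  kvec ℓ p z ⬝ᵥ ((gram ℓ p + (σ ^ 2 / α) • (1 : Matrix (Fin n) (Fin n) ℝ))⁻¹ *ᵥ y)

/-- Variance at `z` of the `α`-tempered Gaussian process posterior:
`k(z, z) - k(z)ᵀ (K + (σ²/α) I)⁻¹ k(z)`. -/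
def postVar {d n : ℕ} (σ α : ℝ) (ℓ : Fin d → ℝ) (p : Fin n → E d) (z : E d) : ℝ :=
  seKernel ℓ z z -
    kvec ℓ p z ⬝ᵥ ((gram ℓ p + (σ ^ 2 / α) • (1 : Matrix (Fin n) (Fin n) ℝ))⁻¹ *ᵥ kvec ℓ p z)

/-- Standard deviation at `z` of the `α`-tempered posterior. -/
def postStd {d n : ℕ} (σ α : ℝ) (ℓ : Fin d → ℝ) (p : Fin n → E d) (z : E d) : ℝ :=
  Real.sqrt (postVar σ α ℓ p z)

/-- `τ_g(v) = ∫_v^∞ (u - v)^g φ(u) du`, where `φ` is the standard normal density. -/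
def tau (g v : ℝ) : ℝ :=
  ∫ u in Set.Ioi v, (u - v) ^ g * gaussianPDFReal 0 1 u

/-- The inverse function of `τ_g`. -/
def tauInv (g : ℝ) : ℝ → ℝ :=
  Function.invFun (tau g)

/-- `C_(g) = 2^(g/2) Γ((g+1)/2) / (2 √π)`. -/
def Cg (g : ℝ) : ℝ :=
  (2 : ℝ) ^ (g / 2) * Real.Gamma ((g + 1) / 2) / (2 * Real.sqrt Real.pi)

/-- The largest posterior mean `max_{x ∈ X} μ(x)`. -/
def maxPostMean {d n : ℕ} (X : Set (E d)) (σ α : ℝ) (ℓ : Fin d → ℝ) (p : Fin n → E d)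
    (y : Fin n → ℝ) : ℝ :=
  ⨆ z : X, postMean σ α ℓ p y z

/-- Rescaled `g`-EI acquisition function `ν^g σ(z)^g τ_g(v(z)/ν)` with
`v(z) = (max_{x ∈ X} μ(x) - μ(z)) / σ(z)`. -/
def acquisition {d n : ℕ} (X : Set (E d)) (σ α g ν : ℝ) (ℓ : Fin d → ℝ) (p : Fin n → E d)
    (y : Fin n → ℝ) (z : E d) : ℝ :=
  ν ^ g * postStd σ α ℓ p z ^ g *
    tau g ((maxPostMean X σ α ℓ p y - postMean σ α ℓ p y z) / postStd σ α ℓ p z / ν)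

/-- Tempered maximum information gain `γ_{t,α}` after `t` observations: the maximum of
`(1/2) log det (I + α σ⁻² K_A)` over `t`-tuples `A` of points of `X` (repetitions allowed). -/
def maxInfoGain {d : ℕ} (X : Set (E d)) (σ α : ℝ) (ℓ : Fin d → ℝ) (t : ℕ) : ℝ :=
  ⨆ A : Fin t → X, (1 / 2) *
    Real.log (1 + (α / σ ^ 2) • gram ℓ fun i => (A i : E d)).det

/-- `m_{α,t} = √α (√γ_{t-1,α} + √(log (2 t² π² / (3 δ))))`, for rounds `t ≥ 1`. -/
def mWidth {d : ℕ} (X : Set (E d)) (σ α δ : ℝ) (ℓ : Fin d → ℝ) (t : ℕ) : ℝ :=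
  Real.sqrt α * (Real.sqrt (maxInfoGain X σ α ℓ (t - 1)) +
    Real.sqrt (Real.log (2 * (t : ℝ) ^ 2 * Real.pi ^ 2 / (3 * δ))))

/-- `C₂ = ∏ᵢ θᵁᵢ / θᴸᵢ`. -/
def lengthscaleRatio {d : ℕ} (θL θU : Fin d → ℝ) : ℝ :=
  ∏ i, θU i / θL i

/-- `β_{T,α,g}` as a function of the constants `C₁`, `C₃` and of the RKHS norm `normf` of the
objective. -/
def betaRate {d : ℕ} (X : Set (E d)) (σ α δ g C₁ C₃ : ℝ) (θL θU : Fin d → ℝ) (normf : ℝ)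
    (T : ℕ) : ℝ :=
  Real.sqrt (2 * lengthscaleRatio θL θU) * normf +
    (C₁ * C₃ * Cg g ^ (1 / g) + 2 * Real.sqrt 2 +
      C₁ * tauInv g (Cg g * (σ ^ 2 / (α * ((T : ℝ) - 1) + σ ^ 2)) ^ (g / 2))) *
    mWidth X σ α δ θL T

/-- The first `n` queried points `x₁, …, xₙ`. -/
def design {d : ℕ} {X : Set (E d)} {Ω : Type*} (x : ℕ → Ω → X) (n : ℕ) (ω : Ω) : Fin n → E d :=
  fun i => (x (i + 1) ω : E d)

/-- The first `n` observations `y_s = f(x_s) + ε_s`. -/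
def observations {d : ℕ} {X : Set (E d)} {Ω : Type*} (f : X → ℝ) (ε : ℕ → Ω → ℝ) (x : ℕ → Ω → X)
    (n : ℕ) (ω : Ω) : Fin n → ℝ :=
  fun i => f (x (i + 1) ω) + ε (i + 1) ω

/-- A run of Bayesian optimization with the `α`-tempered Gaussian process surrogate and the rescaled
`g`-EI acquisition function.  Rounds are numbered from `1` (index `0` of the sequences is unused);
`ℱ t` is the information available after round `t`, and `θ t`, `ν t` are the lengthscales and the
rescaling parameter used in round `t`. -/
structure IsRun {d : ℕ} {X : Set (E d)} {Ω : Type*} {mΩ : MeasurableSpace Ω} (P : Measure Ω)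
    (σ α g : ℝ) (f : X → ℝ) (ℱ : Filtration ℕ mΩ) (ε : ℕ → Ω → ℝ) (θ : ℕ → Ω → Fin d → ℝ)
    (ν : ℕ → Ω → ℝ) (x : ℕ → Ω → X) : Prop where
  /-- the query of a round is decided before its noise is seen -/
  query_measurable : ∀ t, Measurable[ℱ t] (x (t + 1))
  noise_measurable : ∀ t, Measurable[ℱ (t + 1)] (ε (t + 1))
  /-- the noise is independent of the past -/
  noise_indep : ∀ t, Indep (MeasurableSpace.comap (ε (t + 1)) inferInstance) (ℱ t) P
  /-- the noise is `N(0, σ²)` -/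
  noise_law : ∀ t, P.map (ε (t + 1)) = gaussianReal 0 (Real.toNNReal (σ ^ 2))
  /-- the query of round `t + 1` maximizes the acquisition function computed from the data of the
  first `t` rounds -/
  query_max : ∀ t ω, ∀ z : X,
    acquisition X σ α g (ν (t + 1) ω) (θ (t + 1) ω) (design x t ω) (observations f ε x t ω) z ≤
      acquisition X σ α g (ν (t + 1) ω) (θ (t + 1) ω) (design x t ω) (observations f ε x t ω)
        (x (t + 1) ω)

/-- Cumulative regret `R_T = ∑_{t=1}^T (f(x⋆) - f(x_t))`. -/
def cumRegret {d : ℕ} {X : Set (E d)} {Ω : Type*} (f : X → ℝ) (xstar : X) (x : ℕ → Ω → X)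
    (T : ℕ) (ω : Ω) : ℝ :=
  ∑ t ∈ Finset.Icc 1 T, (f xstar - f (x t ω))

end TemperedBO

end

/-! The core is a confidence band `|f - μ| ≤ M * m * s`, with `m` the width `mWidth` and `s` the
posterior standard deviation, valid with probability at least `1 - δ` for all rounds and all
lengthscales in the box at once (`exists_confidence_width`). Uniformity over the box is what lets
the lengthscales depend on the data in any way.

The error of the posterior mean splits into bias and noise. The bias is a linear functional of `f`
whose squared RKHS norm is a quadratic form in the kernel matrix. Comparing Gaussian spectral
densities bounds the form of the largest lengthscales by that of the current ones times the product
of their ratios, and the latter form is at most the posterior variance (`regression_bias_le`). For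
the noise, a Cauchy-Schwarz inequality leaves the form `yᵀ K (K + (σ²/α) I)⁻¹ y`
(`sq_regression_le`). For a fixed kernel this is, up to scaling and the information gain, the
logarithm of a density ratio of mean one (`IsRun.lintegral_likelihoodRatio`), so Markov's inequality
controls it. A union bound over a grid of lengthscales refined with the sample size covers the box,
because the regularization absorbs the rounding error. As `m ≥ √α`, the bias bound is absorbed into
`M` too.

Given the band, the regret of a round is at most `s` times the bracket in `regret_le`. The posterior
gap of the query is bounded by comparing its acquisition value with that of a maximizer of the
posterior mean. The optimism at the optimum is bounded by comparing with `xstar`; there the power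
mean inequality `τ_1 ^ g ≤ τ_g` reduces the argument to `g = 1` and keeps the constant free of `g`.

Posterior variances and information gains only grow when the lengthscales shrink (`postVar_anti`,
`infoGain_anti`), so every round is measured with the smallest lengthscales. Cauchy-Schwarz over the
rounds and the bound of summed variances by information gain (`sum_postStd_le`) then give the rate.
-/

noncomputable section

namespace TemperedBO

/-! ### Schur complements and comparison of positive definite matrices. -/

section LinearAlgebra

/-- Leading principal submatrix, obtained by deleting the last row and column. -/
def lead {n : ℕ} (M : Matrix (Fin (n + 1)) (Fin (n + 1)) ℝ) : Matrix (Fin n) (Fin n) ℝ :=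
  M.submatrix Fin.castSucc Fin.castSucc

/-- Last column without its diagonal entry. -/
def lastCol {n : ℕ} (M : Matrix (Fin (n + 1)) (Fin (n + 1)) ℝ) : Fin n → ℝ :=
  fun i => M i.castSucc (Fin.last n)

/-- Schur complement of the leading block. -/
def schur {n : ℕ} (M : Matrix (Fin (n + 1)) (Fin (n + 1)) ℝ) : ℝ :=
  M (Fin.last n) (Fin.last n) - lastCol M ⬝ᵥ ((lead M)⁻¹ *ᵥ lastCol M)

variable {n : ℕ} {M M' : Matrix (Fin (n + 1)) (Fin (n + 1)) ℝ}

lemma posDef_lead (hM : M.PosDef) : (lead M).PosDef :=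
  hM.submatrix (Fin.castSucc_injective n)

lemma mulVec_inv_mulVec {ι : Type*} [Fintype ι] [DecidableEq ι] {A : Matrix ι ι ℝ}
    (hA : A.PosDef) (y : ι → ℝ) : A *ᵥ (A⁻¹ *ᵥ y) = y := by
  rw [Matrix.mulVec_mulVec, Matrix.mul_nonsing_inv _ ((Matrix.isUnit_iff_isUnit_det _).1 hA.isUnit),
    Matrix.one_mulVec]

lemma inv_mulVec_mulVec {ι : Type*} [Fintype ι] [DecidableEq ι] {A : Matrix ι ι ℝ}
    (hA : A.PosDef) (y : ι → ℝ) : A⁻¹ *ᵥ (A *ᵥ y) = y := by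
  rw [Matrix.mulVec_mulVec, Matrix.nonsing_inv_mul _ ((Matrix.isUnit_iff_isUnit_det _).1 hA.isUnit),
    Matrix.one_mulVec]

lemma dotProduct_mulVec_symm {ι : Type*} [Fintype ι] {A : Matrix ι ι ℝ}
    (hA : A.IsHermitian) (x y : ι → ℝ) : x ⬝ᵥ (A *ᵥ y) = y ⬝ᵥ (A *ᵥ x) := by
  have h : Aᵀ = A := by
    ext i j
    simpa using hA.apply i j
  rw [Matrix.dotProduct_mulVec, ← Matrix.mulVec_transpose, h, dotProduct_comm]

lemma quad_nonneg {ι : Type*} [Fintype ι] {A : Matrix ι ι ℝ}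
    (hA : A.PosSemidef) (x : ι → ℝ) : 0 ≤ x ⬝ᵥ (A *ᵥ x) := by
  simpa using hA.dotProduct_mulVec_nonneg x

lemma snoc_dotProduct_snoc (a b : Fin n → ℝ) (s t : ℝ) :
    (Fin.snoc a s : Fin (n + 1) → ℝ) ⬝ᵥ (Fin.snoc b t : Fin (n + 1) → ℝ) = a ⬝ᵥ b + s * t := by
  simp [dotProduct, Fin.sum_univ_castSucc]

lemma mulVec_snoc (hM : M.IsHermitian) (w : Fin n → ℝ) (t : ℝ) :
    M *ᵥ (Fin.snoc w t : Fin (n + 1) → ℝ) =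
      (Fin.snoc (lead M *ᵥ w + t • lastCol M)
        (lastCol M ⬝ᵥ w + t * M (Fin.last n) (Fin.last n)) : Fin (n + 1) → ℝ) := by
  ext i
  refine Fin.lastCases ?_ (fun i => ?_) i
  · simp only [Matrix.mulVec, dotProduct, Fin.sum_univ_castSucc, Fin.snoc_castSucc, Fin.snoc_last,
      lastCol]
    rw [mul_comm t]
    congr 1
    refine Finset.sum_congr rfl fun j _ => ?_
    have := hM.apply j.castSucc (Fin.last n)
    simp only [star_trivial] at this
    rw [this]
  · simp [Matrix.mulVec, dotProduct, Fin.sum_univ_castSucc, lead, lastCol, mul_comm t]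

/-- Completing the square in the first block. -/
lemma quad_snoc (hM : M.PosDef) (w : Fin n → ℝ) (t : ℝ) :
    (Fin.snoc w t : Fin (n + 1) → ℝ) ⬝ᵥ (M *ᵥ (Fin.snoc w t : Fin (n + 1) → ℝ)) =
      (w + t • ((lead M)⁻¹ *ᵥ lastCol M)) ⬝ᵥ
        (lead M *ᵥ (w + t • ((lead M)⁻¹ *ᵥ lastCol M))) + t ^ 2 * schur M := by
  have hA := posDef_lead hM
  rw [mulVec_snoc hM.isHermitian, snoc_dotProduct_snoc, schur]
  set u := (lead M)⁻¹ *ᵥ lastCol M with hu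
  have hAu : lead M *ᵥ u = lastCol M := mulVec_inv_mulVec hA _
  have h2 : u ⬝ᵥ (lead M *ᵥ w) = w ⬝ᵥ lastCol M := by
    rw [dotProduct_mulVec_symm hA.isHermitian, hAu]
  simp only [Matrix.mulVec_add, Matrix.mulVec_smul, hAu, dotProduct_add, add_dotProduct,
    smul_dotProduct, dotProduct_smul, h2, smul_eq_mul]
  rw [dotProduct_comm (lastCol M) w, dotProduct_comm u]
  ring

/-- Dropping the square in `quad_snoc`. Together with `schur_eq_quad` it describes the Schur
complement as the minimum of the form over vectors with last coordinate `1`; comparisons of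
posterior variances rest on this. -/
lemma schur_le_quad (hM : M.PosDef) (w : Fin n → ℝ) (t : ℝ) :
    t ^ 2 * schur M ≤
      (Fin.snoc w t : Fin (n + 1) → ℝ) ⬝ᵥ (M *ᵥ (Fin.snoc w t : Fin (n + 1) → ℝ)) := by
  rw [quad_snoc hM]
  have := quad_nonneg (posDef_lead hM).posSemidef (w + t • ((lead M)⁻¹ *ᵥ lastCol M))
  linarith

lemma schur_eq_quad (hM : M.PosDef) :
    schur M =
      (Fin.snoc (-((lead M)⁻¹ *ᵥ lastCol M)) 1 : Fin (n + 1) → ℝ) ⬝ᵥ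
        (M *ᵥ (Fin.snoc (-((lead M)⁻¹ *ᵥ lastCol M)) 1 : Fin (n + 1) → ℝ)) := by
  rw [quad_snoc hM]
  simp

lemma schur_pos (hM : M.PosDef) : 0 < schur M := by
  rw [schur_eq_quad hM]
  have := hM.dotProduct_mulVec_pos (x := (Fin.snoc (-((lead M)⁻¹ *ᵥ lastCol M)) 1 : Fin (n + 1) → ℝ))
    (fun h => by simpa using congrFun h (Fin.last n))
  simpa using this

lemma inv_quad_snoc (hM : M.PosDef) (y : Fin n → ℝ) (η : ℝ) :
    (Fin.snoc y η : Fin (n + 1) → ℝ) ⬝ᵥ (M⁻¹ *ᵥ (Fin.snoc y η : Fin (n + 1) → ℝ)) =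
      y ⬝ᵥ ((lead M)⁻¹ *ᵥ y) + (η - lastCol M ⬝ᵥ ((lead M)⁻¹ *ᵥ y)) ^ 2 / schur M := by
  have hA := posDef_lead hM
  have hs := schur_pos hM
  set u := (lead M)⁻¹ *ᵥ lastCol M with hu
  set a := (lead M)⁻¹ *ᵥ y with ha
  have hAu : lead M *ᵥ u = lastCol M := mulVec_inv_mulVec hA _
  have hAa : lead M *ᵥ a = y := mulVec_inv_mulVec hA _
  have hsc : schur M = M (Fin.last n) (Fin.last n) - lastCol M ⬝ᵥ u := rfl
  set c := (η - lastCol M ⬝ᵥ a) / schur M with hc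
  have hcs : c * schur M = η - lastCol M ⬝ᵥ a := div_mul_cancel₀ _ hs.ne'
  -- Block elimination: the preimage of `(y, η)` under `M` is written down explicitly instead of
  -- inverting `M`.
  have key : M *ᵥ (Fin.snoc (a - c • u) c : Fin (n + 1) → ℝ) = Fin.snoc y η := by
    rw [mulVec_snoc hM.isHermitian, Matrix.mulVec_sub, Matrix.mulVec_smul, hAa, hAu,
      sub_add_cancel, dotProduct_sub, dotProduct_smul]
    congr 1
    rw [hsc] at hcs
    simp only [smul_eq_mul]
    linarith
  have hyu : y ⬝ᵥ u = lastCol M ⬝ᵥ a := by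
    rw [← hAa, dotProduct_comm, dotProduct_mulVec_symm hA.isHermitian, hAu, dotProduct_comm]
  rw [← key, inv_mulVec_mulVec hM, key, snoc_dotProduct_snoc, dotProduct_sub, dotProduct_smul, hyu,
    smul_eq_mul, hc]
  field_simp
  ring

lemma det_eq_det_lead_mul_schur (hM : M.PosDef) : M.det = (lead M).det * schur M := by
  have hA := posDef_lead hM
  set B : Matrix (Fin n) (Fin 1) ℝ := M.submatrix Fin.castSucc (Fin.natAdd n) with hB
  set D : Matrix (Fin 1) (Fin 1) ℝ := M.submatrix (Fin.natAdd n) (Fin.natAdd n) with hD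
  have hblock : M.submatrix finSumFinEquiv finSumFinEquiv
      = Matrix.fromBlocks (lead M) B (M.submatrix (Fin.natAdd n) Fin.castSucc) D := by
    ext i j
    rcases i with i | i <;> rcases j with j | j <;> rfl
  let _ : Invertible (lead M) := hA.isUnit.invertible
  rw [← Matrix.det_submatrix_equiv_self (finSumFinEquiv (m := n) (n := 1)) M, hblock,
    Matrix.det_fromBlocks₁₁]
  congr 1
  rw [Matrix.det_fin_one, Matrix.invOf_eq_nonsing_inv]
  have hlast : (Fin.natAdd n (0 : Fin 1)) = Fin.last n := by ext; simp
  simp only [Matrix.sub_apply, schur, hD, Matrix.submatrix_apply, hlast]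
  congr 1
  rw [Matrix.mul_assoc, Matrix.mul_apply]
  simp only [Matrix.submatrix_apply, hlast, dotProduct]
  refine Finset.sum_congr rfl fun i _ => ?_
  have := hM.isHermitian.apply i.castSucc (Fin.last n)
  simp only [star_trivial] at this
  rw [this]
  congr 1

/-- The minimizing vector of `M'` is a test vector for `M`. -/
lemma schur_le_mul_schur (hM : M.PosDef) (hM' : M'.PosDef) {c : ℝ}
    (h : (c • M' - M).PosSemidef) : schur M ≤ c * schur M' := by
  set v := (Fin.snoc (-((lead M')⁻¹ *ᵥ lastCol M')) 1 : Fin (n + 1) → ℝ) with hv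
  have h1 := schur_le_quad hM (-((lead M')⁻¹ *ᵥ lastCol M')) 1
  have h2 := quad_nonneg h v
  rw [Matrix.sub_mulVec, dotProduct_sub, Matrix.smul_mulVec, dotProduct_smul,
    ← schur_eq_quad hM', smul_eq_mul] at h2
  rw [← hv] at h1
  linarith

/-- With `J` the unit matrix of the last diagonal entry, `M - schur M • J` is positive semidefinite.
By the Schur product theorem it stays so after the Hadamard product with `C`, which fixes `J`;
testing on the minimizing vector of `M ⊙ C` concludes. -/
lemma schur_le_schur_hadamard {C : Matrix (Fin (n + 1)) (Fin (n + 1)) ℝ} (hM : M.PosDef)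
    (hMC : (M ⊙ C).PosDef) (hC : C.PosSemidef)
    (hlast : C (Fin.last n) (Fin.last n) = 1) : schur M ≤ schur (M ⊙ C) := by
  set e : Fin (n + 1) → ℝ := Pi.single (Fin.last n) 1 with he
  set J : Matrix (Fin (n + 1)) (Fin (n + 1)) ℝ := Matrix.vecMulVec e e with hJ
  have hquadJ : ∀ v : Fin (n + 1) → ℝ, v ⬝ᵥ (J *ᵥ v) = v (Fin.last n) ^ 2 := by
    intro v
    rw [hJ, Matrix.vecMulVec_mulVec]
    simp [he]
    ring
  have hJh : J.IsHermitian := by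
    ext i j
    simp [hJ, Matrix.vecMulVec_apply, mul_comm]
  have h1 : (M - schur M • J).PosSemidef := by
    refine .of_dotProduct_mulVec_nonneg (hM.isHermitian.sub (by
      ext i j; simpa using Or.inl (by simpa using hJh.apply i j))) fun v => ?_
    have hv : v = (Fin.snoc (fun i => v i.castSucc) (v (Fin.last n)) : Fin (n + 1) → ℝ) :=
      (Fin.snoc_init_self v).symm
    have := schur_le_quad hM (fun i => v i.castSucc) (v (Fin.last n))
    rw [← hv] at this
    simp only [star_trivial, Matrix.sub_mulVec, dotProduct_sub, Matrix.smul_mulVec, dotProduct_smul,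
      hquadJ, smul_eq_mul]
    linarith
  have h2 := h1.hadamard hC
  have hJC : (M - schur M • J) ⊙ C = M ⊙ C - schur M • J := by
    ext i j
    simp only [Matrix.hadamard_apply, Matrix.sub_apply, Matrix.smul_apply, smul_eq_mul, hJ,
      Matrix.vecMulVec_apply, he, Pi.single_apply]
    by_cases hi : i = Fin.last n <;> by_cases hj : j = Fin.last n <;> simp [hi, hj, hlast]
  rw [hJC] at h2
  have h3 := quad_nonneg h2
    (Fin.snoc (-((lead (M ⊙ C))⁻¹ *ᵥ lastCol (M ⊙ C))) 1 : Fin (n + 1) → ℝ)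
  rw [Matrix.sub_mulVec, dotProduct_sub, Matrix.smul_mulVec, dotProduct_smul, hquadJ,
    ← schur_eq_quad hMC] at h3
  simp only [Fin.snoc_last, smul_eq_mul] at h3
  linarith

lemma det_le_pow_mul_det {n : ℕ} {A A' : Matrix (Fin n) (Fin n) ℝ} (hA : A.PosDef)
    (hA' : A'.PosDef) {c : ℝ} (hc : 0 ≤ c) (h : (c • A' - A).PosSemidef) :
    A.det ≤ c ^ n * A'.det := by
  induction n with
  | zero => simp
  | succ n ih =>
    rw [det_eq_det_lead_mul_schur hA, det_eq_det_lead_mul_schur hA']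
    have h1 := ih (posDef_lead hA) (posDef_lead hA') (h.submatrix Fin.castSucc)
    have h2 := schur_le_mul_schur hA hA' h
    calc _ ≤ (c ^ n * (lead A').det) * (c * schur A') :=
          mul_le_mul h1 h2 (schur_pos hA).le
            (mul_nonneg (pow_nonneg hc _) (posDef_lead hA').det_pos.le)
      _ = _ := by ring

/-- Inversion reverses the order of positive definite matrices: expand the nonnegative form of `A`
at `c A⁻¹ y - A'⁻¹ y`. -/
lemma inv_quad_le {ι : Type*} [Fintype ι] [DecidableEq ι] {A A' : Matrix ι ι ℝ} (hA : A.PosDef)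
    (hA' : A'.PosDef) {c : ℝ} (hc : 0 < c) (h : (c • A' - A).PosSemidef) (y : ι → ℝ) :
    y ⬝ᵥ (A'⁻¹ *ᵥ y) ≤ c * (y ⬝ᵥ (A⁻¹ *ᵥ y)) := by
  set u := A'⁻¹ *ᵥ y with hu
  set a := A⁻¹ *ᵥ y with ha
  have hAu : A' *ᵥ u = y := mulVec_inv_mulVec hA' _
  have hAa : A *ᵥ a = y := mulVec_inv_mulVec hA _
  have h1 := quad_nonneg h u
  rw [Matrix.sub_mulVec, dotProduct_sub, Matrix.smul_mulVec, dotProduct_smul, hAu, smul_eq_mul,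
    dotProduct_comm u y] at h1
  have h2 := quad_nonneg hA.posSemidef (c • a - u)
  simp only [Matrix.mulVec_sub, Matrix.mulVec_smul, hAa, dotProduct_sub, sub_dotProduct,
    smul_dotProduct, dotProduct_smul, smul_eq_mul] at h2
  rw [dotProduct_mulVec_symm hA.isHermitian a u, hAa, dotProduct_comm a y,
    dotProduct_comm u y] at h2
  have h3 : 0 ≤ c * (c * (y ⬝ᵥ a) - y ⬝ᵥ u) := by nlinarith
  have := nonneg_of_mul_nonneg_right h3 hc
  linarith

lemma posDef_of_sub_smul_one {ι : Type*} [Fintype ι] [DecidableEq ι] {A : Matrix ι ι ℝ} {c : ℝ}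
    (hc : 0 < c) (h : (A - c • (1 : Matrix ι ι ℝ)).PosSemidef) : A.PosDef := by
  have := (Matrix.PosDef.one (n := ι) (R := ℝ)).smul hc |>.add_posSemidef h
  rwa [add_sub_cancel] at this

/-- Cauchy-Schwarz inequality for regularized regression on pure noise. -/
lemma sq_regression_le {c : ℝ} (hc : 0 < c) (h : (M - c • 1).PosSemidef) (hs : c < schur M)
    (y : Fin n → ℝ) :
    (lastCol M ⬝ᵥ ((lead M)⁻¹ *ᵥ y)) ^ 2 ≤
      (schur M - c) * ((y ⬝ᵥ y - c * (y ⬝ᵥ ((lead M)⁻¹ *ᵥ y))) / c) := by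
  have hM := posDef_of_sub_smul_one hc h
  set μ := lastCol M ⬝ᵥ ((lead M)⁻¹ *ᵥ y) with hμ
  set Q := y ⬝ᵥ ((lead M)⁻¹ *ᵥ y) with hQ
  set p := schur M - c with hp
  have hp0 : 0 < p := sub_pos.2 hs
  -- The extra coordinate that minimizes the difference of the two sides of `M⁻¹ ≤ c⁻¹ I`, so that
  -- the inequality becomes sharpest.
  set η := -(c * μ / p) with hη
  have h1 := inv_quad_le (Matrix.PosDef.one (n := Fin (n + 1)) (R := ℝ)) hM (inv_pos.2 hc)
    (by have := h.smul (inv_pos.2 hc).le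
        rwa [smul_sub, smul_smul, inv_mul_cancel₀ hc.ne', one_smul] at this)
    (Fin.snoc y η)
  rw [inv_quad_snoc hM, inv_one, Matrix.one_mulVec, snoc_dotProduct_snoc, ← hμ, ← hQ,
    (by rw [hp]; ring : schur M = p + c), ← sub_nonneg] at h1
  have h2 : c⁻¹ * (y ⬝ᵥ y + η * η) - (Q + (η - μ) ^ 2 / (p + c)) =
      (p * ((y ⬝ᵥ y - c * Q) / c) - μ ^ 2) / p := by
    rw [hη]
    field_simp
    ring
  rw [h2] at h1
  have := mul_nonneg h1 hp0.le
  rw [div_mul_cancel₀ _ hp0.ne'] at this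
  linarith

end LinearAlgebra

/-! ### One-dimensional Gaussian kernels through their spectral densities. -/

section KernelComparison

open scoped NNReal

variable {ι κ : Type*}

lemma posSemidef_ones [Fintype ι] : (Matrix.of fun _ _ : ι => (1 : ℝ)).PosSemidef := by
  have := Matrix.posSemidef_vecMulVec_self_star (fun _ : ι => (1 : ℝ))
  convert! this using 1
  ext i j
  simp [Matrix.vecMulVec_apply]

lemma posSemidef_prod [Fintype ι] (A : κ → Matrix ι ι ℝ) (hA : ∀ l, (A l).PosSemidef) (S : Finset κ) :
    (Matrix.of fun i j => ∏ l ∈ S, A l i j).PosSemidef := by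
  classical
  induction S using Finset.induction_on with
  | empty => simpa using posSemidef_ones
  | insert a S ha ih =>
    convert! (hA a).hadamard ih using 1
    ext i j
    simp [Finset.prod_insert ha]

/-- Telescoping: `∏ A - ∏ B` changes one factor at a time, and each term is a Hadamard product of
positive semidefinite matrices. -/
lemma posSemidef_prod_sub_prod [Fintype ι] (A B : κ → Matrix ι ι ℝ) (hA : ∀ l, (A l).PosSemidef)
    (hB : ∀ l, (B l).PosSemidef) (hAB : ∀ l, (A l - B l).PosSemidef) (S : Finset κ) :
    ((Matrix.of fun i j => ∏ l ∈ S, A l i j) - Matrix.of fun i j => ∏ l ∈ S, B l i j).PosSemidef := by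
  classical
  induction S using Finset.induction_on with
  | empty => simpa using Matrix.PosSemidef.zero
  | insert a S ha ih =>
    convert! ((hAB a).hadamard (posSemidef_prod A hA S)).add ((hB a).hadamard ih) using 1
    ext i j
    simp only [Finset.prod_insert ha, Matrix.sub_apply, Matrix.of_apply, Matrix.add_apply,
      Matrix.hadamard_apply]
    ring

/-- Kernel matrix of the one-dimensional Gaussian kernel with precision `s`. -/
def gauss1 (s : ℝ≥0) (a : ι → ℝ) : Matrix ι ι ℝ :=
  Matrix.of fun i j => Real.exp (-(s / 2) * (a i - a j) ^ 2)

/-- Squared modulus of the trigonometric polynomial with frequencies `a` and coefficients `v`. -/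
def trigSq [Fintype ι] (a v : ι → ℝ) (u : ℝ) : ℝ :=
  (∑ i, v i * Real.cos (a i * u)) ^ 2 + (∑ i, v i * Real.sin (a i * u)) ^ 2

lemma trigSq_nonneg [Fintype ι] (a v : ι → ℝ) (u : ℝ) : 0 ≤ trigSq a v u := by
  unfold trigSq
  positivity

lemma trigSq_eq [Fintype ι] (a v : ι → ℝ) (u : ℝ) :
    trigSq a v u = ∑ i, ∑ j, v i * v j * Real.cos ((a i - a j) * u) := by
  rw [trigSq, sq, sq, Finset.sum_mul_sum, Finset.sum_mul_sum, ← Finset.sum_add_distrib]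
  refine Finset.sum_congr rfl fun i _ => ?_
  rw [← Finset.sum_add_distrib]
  refine Finset.sum_congr rfl fun j _ => ?_
  rw [sub_mul, Real.cos_sub]
  ring

lemma integrable_cos_gaussianReal (s : ℝ≥0) (r : ℝ) :
    Integrable (fun u => Real.cos (r * u)) (gaussianReal 0 s) := by
  refine Integrable.of_bound (by fun_prop) 1 (ae_of_all _ fun u => ?_)
  simpa using Real.abs_cos_le_one _

lemma integral_cos_gaussianReal (s : ℝ≥0) (r : ℝ) :
    ∫ u, Real.cos (r * u) ∂gaussianReal 0 s = Real.exp (-(s / 2) * r ^ 2) := by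
  have h := charFun_gaussianReal (μ := 0) (v := s) r
  rw [charFun_apply_real] at h
  have h2 := congrArg Complex.re h
  have hint : Integrable (fun u : ℝ => Complex.exp (r * u * Complex.I)) (gaussianReal 0 s) := by
    refine Integrable.of_bound (by fun_prop) 1 (ae_of_all _ fun u => ?_)
    rw [← Complex.ofReal_mul, Complex.norm_exp_ofReal_mul_I]
  rw [← RCLike.re_eq_complex_re, ← integral_re hint] at h2
  have h3 : ∀ u : ℝ, RCLike.re (Complex.exp (r * u * Complex.I)) = Real.cos (r * u) := by
    intro u
    rw [← Complex.ofReal_mul, RCLike.re_eq_complex_re, Complex.exp_ofReal_mul_I_re]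
  simp_rw [h3] at h2
  rw [h2, RCLike.re_eq_complex_re]
  have : ((r : ℂ) * ((0 : ℝ) : ℂ) * Complex.I - (s : ℝ) * (r : ℂ) ^ 2 / 2)
      = ((-(s / 2) * r ^ 2 : ℝ) : ℂ) := by
    push_cast
    ring
  rw [this, Complex.exp_ofReal_re]

/-- Bochner's representation: the kernel of precision `s` is the characteristic function of `N(0,
s)`. Positivity and comparison of kernels thus reduce to pointwise statements on densities. -/
lemma quad_gauss1 [Fintype ι] (s : ℝ≥0) (a v : ι → ℝ) :
    v ⬝ᵥ (gauss1 s a *ᵥ v) = ∫ u, trigSq a v u ∂gaussianReal 0 s := by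
  simp_rw [trigSq_eq]
  rw [integral_finsetSum _ fun i _ => integrable_finsetSum _ fun j _ =>
    (integrable_cos_gaussianReal s _).const_mul _]
  simp only [dotProduct, Matrix.mulVec, Finset.mul_sum]
  refine Finset.sum_congr rfl fun i _ => ?_
  rw [integral_finsetSum _ fun j _ => (integrable_cos_gaussianReal s _).const_mul _]
  refine Finset.sum_congr rfl fun j _ => ?_
  rw [integral_const_mul, integral_cos_gaussianReal, gauss1, Matrix.of_apply]
  ring

lemma integrable_trigSq [Fintype ι] (s : ℝ≥0) (a v : ι → ℝ) : Integrable (trigSq a v) (gaussianReal 0 s) := by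
  have : trigSq a v = fun u => ∑ i, ∑ j, v i * v j * Real.cos ((a i - a j) * u) :=
    funext (trigSq_eq a v)
  rw [this]
  exact integrable_finsetSum _ fun i _ => integrable_finsetSum _ fun j _ =>
    (integrable_cos_gaussianReal s _).const_mul _

lemma isHermitian_gauss1 (s : ℝ≥0) (a : ι → ℝ) : (gauss1 s a).IsHermitian := by
  ext i j
  simp only [gauss1, Matrix.conjTranspose_apply, Matrix.of_apply, star_trivial]
  rw [← neg_sub (a i), neg_sq]

lemma posSemidef_gauss1 [Fintype ι] (s : ℝ≥0) (a : ι → ℝ) : (gauss1 s a).PosSemidef := by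
  refine .of_dotProduct_mulVec_nonneg (isHermitian_gauss1 s a) fun v => ?_
  rw [star_trivial, quad_gauss1]
  exact integral_nonneg fun u => trigSq_nonneg a v u

/-- A smaller variance makes the exponential factor smaller, so only the ratio of normalizing
constants is lost. -/
lemma gaussianPDFReal_le_mul {s s' : ℝ≥0} (hs' : 0 < s') (hss : s' ≤ s) (u : ℝ) :
    gaussianPDFReal 0 s' u ≤ Real.sqrt (s / s') * gaussianPDFReal 0 s u := by
  have hs'0 : (0 : ℝ) < s' := hs'
  have hs0 : (0 : ℝ) < s := lt_of_lt_of_le hs' hss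
  have h1 : (Real.sqrt (2 * Real.pi * s'))⁻¹ = Real.sqrt (s / s') * (Real.sqrt (2 * Real.pi * s))⁻¹ := by
    rw [← Real.sqrt_inv, ← Real.sqrt_inv, ← Real.sqrt_mul (by positivity)]
    congr 1
    field_simp
  simp only [gaussianPDFReal]
  rw [h1, mul_assoc, neg_div, neg_div]
  gcongr

lemma posSemidef_gauss1_sub [Fintype ι] {s s' : ℝ≥0} (hs' : 0 < s') (hss : s' ≤ s) (a : ι → ℝ) :
    (Real.sqrt (s / s') • gauss1 s a - gauss1 s' a).PosSemidef := by
  have hs : 0 < s := lt_of_lt_of_le hs' hss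
  refine .of_dotProduct_mulVec_nonneg (((isHermitian_gauss1 s a).smul (by
    exact IsSelfAdjoint.all _)).sub (isHermitian_gauss1 s' a)) fun v => ?_
  rw [star_trivial, Matrix.sub_mulVec, dotProduct_sub, Matrix.smul_mulVec, dotProduct_smul,
    quad_gauss1, quad_gauss1, smul_eq_mul, sub_nonneg, ← integral_const_mul,
    integral_gaussianReal_eq_integral_smul hs.ne', integral_gaussianReal_eq_integral_smul hs'.ne']
  refine integral_mono_of_nonneg (ae_of_all _ fun u => ?_) ?_ (ae_of_all _ fun u => ?_)
  · exact mul_nonneg (gaussianPDFReal_nonneg _ _ _) (trigSq_nonneg a v u)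
  · have h := (integrable_trigSq s a v).const_mul (Real.sqrt (s / s'))
    rw [gaussianReal_of_var_ne_zero _ hs.ne', integrable_withDensity_iff_integrable_smul'
      (measurable_gaussianPDF _ _) (ae_of_all _ fun x => by simp [gaussianPDF])] at h
    simpa [toReal_gaussianPDF] using h
  · have := mul_le_mul_of_nonneg_right (gaussianPDFReal_le_mul hs' hss u) (trigSq_nonneg a v u)
    simp only [smul_eq_mul]
    linarith

end KernelComparison

/-! ### Posterior variance and information gain: monotonicity in the lengthscales, chain rule,
variance sums. -/

section Posterior

open scoped NNReal

variable {d n : ℕ} {σ α : ℝ}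

lemma seKernel_self (ℓ : Fin d → ℝ) (z : E d) : seKernel ℓ z z = 1 := by
  simp [seKernel]

/-- Precision `1 / ℓ²` of a lengthscale. -/
def prec (a : ℝ) : ℝ≥0 := Real.toNNReal (1 / a ^ 2)

lemma coe_prec (a : ℝ) : (prec a : ℝ) = 1 / a ^ 2 := Real.coe_toNNReal _ (by positivity)

lemma gram_eq_prod (ℓ : Fin d → ℝ) (p : Fin n → E d) :
    gram ℓ p = Matrix.of fun i j => ∏ l, gauss1 (prec (ℓ l)) (fun i => p i l) i j := by
  ext i j
  simp only [gram, seKernel, Matrix.of_apply, gauss1, coe_prec]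
  rw [← Real.exp_sum, Finset.mul_sum]
  congr 1
  refine Finset.sum_congr rfl fun l _ => ?_
  ring

lemma posSemidef_gram (ℓ : Fin d → ℝ) (p : Fin n → E d) : (gram ℓ p).PosSemidef := by
  rw [gram_eq_prod]
  exact posSemidef_prod _ (fun _ => posSemidef_gauss1 _ _) _

/-- Enlarging the lengthscales shrinks the kernel matrix, up to the ratio of the lengthscales. -/
lemma posSemidef_gram_sub {θ θ' : Fin d → ℝ} (hθ : ∀ i, 0 < θ i) (hle : ∀ i, θ i ≤ θ' i)
    (p : Fin n → E d) : ((∏ i, θ' i / θ i) • gram θ p - gram θ' p).PosSemidef := by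
  have h := posSemidef_prod_sub_prod
    (fun l => (θ' l / θ l) • gauss1 (prec (θ l)) (fun i => p i l))
    (fun l => gauss1 (prec (θ' l)) (fun i => p i l))
    (fun l => (posSemidef_gauss1 _ _).smul (div_nonneg ((hθ l).le.trans (hle l)) (hθ l).le))
    (fun _ => posSemidef_gauss1 _ _) (fun l => ?_) Finset.univ
  · convert! h using 1
    ext i j
    simp [gram_eq_prod, Finset.prod_mul_distrib]
  · have h0 := hθ l
    have h1 : 0 < θ' l := h0.trans_le (hle l)
    have hpos : 0 < prec (θ' l) := by
      rw [← NNReal.coe_pos, coe_prec]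
      positivity
    have hpp : prec (θ' l) ≤ prec (θ l) := by
      rw [← NNReal.coe_le_coe, coe_prec, coe_prec]
      have := hle l
      gcongr
    have := posSemidef_gauss1_sub hpos hpp (fun i => p i l)
    rw [coe_prec, coe_prec] at this
    have h3 : (1 / θ l ^ 2) / (1 / θ' l ^ 2) = (θ' l / θ l) ^ 2 := by
      field_simp
    rwa [h3, Real.sqrt_sq (by positivity)] at this

/-- Correlation matrix relating the kernel matrices of two lengthscale vectors. -/
def corr (θ θ' : Fin d → ℝ) (p : Fin n → E d) : Matrix (Fin n) (Fin n) ℝ :=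
  Matrix.of fun i j => ∏ l, gauss1 (Real.toNNReal (1 / θ l ^ 2 - 1 / θ' l ^ 2)) (fun i => p i l) i j

lemma posSemidef_corr (θ θ' : Fin d → ℝ) (p : Fin n → E d) : (corr θ θ' p).PosSemidef :=
  posSemidef_prod _ (fun _ => posSemidef_gauss1 _ _) _

lemma corr_self (θ θ' : Fin d → ℝ) (p : Fin n → E d) (i : Fin n) : corr θ θ' p i i = 1 := by
  simp [corr, gauss1]

/-- Precisions add when Gaussian kernels are multiplied, so the kernel of shorter lengthscales is
the longer one times another Gaussian kernel. -/
lemma gram_hadamard_corr {θ θ' : Fin d → ℝ} (hθ : ∀ i, 0 < θ i) (hle : ∀ i, θ i ≤ θ' i)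
    (p : Fin n → E d) : gram θ' p ⊙ corr θ θ' p = gram θ p := by
  ext i j
  rw [Matrix.hadamard_apply, gram_eq_prod, gram_eq_prod]
  simp only [corr, Matrix.of_apply, gauss1]
  rw [← Finset.prod_mul_distrib]
  refine Finset.prod_congr rfl fun l _ => ?_
  have : 1 / θ' l ^ 2 ≤ 1 / θ l ^ 2 := by
    have := hle l
    have := hθ l
    gcongr
  rw [← Real.exp_add, Real.coe_toNNReal _ (sub_nonneg.2 this), coe_prec, coe_prec]
  ring_nf

/-- Regularized kernel matrix `K + (σ²/α) I`. -/
def regGram (σ α : ℝ) (ℓ : Fin d → ℝ) (p : Fin n → E d) : Matrix (Fin n) (Fin n) ℝ :=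
  gram ℓ p + (σ ^ 2 / α) • (1 : Matrix (Fin n) (Fin n) ℝ)

lemma posDef_regGram (hσ : 0 < σ) (hα : 0 < α) (ℓ : Fin d → ℝ) (p : Fin n → E d) :
    (regGram σ α ℓ p).PosDef := by
  refine posDef_of_sub_smul_one (c := σ ^ 2 / α) (by positivity) ?_
  rw [regGram, add_sub_cancel_right]
  exact posSemidef_gram ℓ p

lemma lead_regGram (ℓ : Fin d → ℝ) (p : Fin (n + 1) → E d) :
    lead (regGram σ α ℓ p) = regGram σ α ℓ (fun i => p i.castSucc) := by
  ext i j
  simp [lead, regGram, gram, Matrix.one_apply]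

lemma lastCol_regGram (ℓ : Fin d → ℝ) (p : Fin (n + 1) → E d) :
    lastCol (regGram σ α ℓ p) = kvec ℓ (fun i => p i.castSucc) (p (Fin.last n)) := by
  ext i
  simp [lastCol, regGram, gram, kvec, (Fin.castSucc_lt_last i).ne]

lemma schur_regGram (ℓ : Fin d → ℝ) (p : Fin (n + 1) → E d) :
    schur (regGram σ α ℓ p) =
      postVar σ α ℓ (fun i => p i.castSucc) (p (Fin.last n)) + σ ^ 2 / α := by
  rw [schur, lead_regGram, lastCol_regGram, postVar]
  simp only [regGram, Matrix.add_apply, Matrix.smul_apply, Matrix.one_apply_eq, smul_eq_mul, mul_one,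
    gram, Matrix.of_apply]
  ring

lemma schur_regGram_snoc (ℓ : Fin d → ℝ) (p : Fin n → E d) (z : E d) :
    schur (regGram σ α ℓ (Fin.snoc p z : Fin (n + 1) → E d)) = postVar σ α ℓ p z + σ ^ 2 / α := by
  rw [schur_regGram]
  simp

lemma lead_regGram_snoc (ℓ : Fin d → ℝ) (p : Fin n → E d) (z : E d) :
    lead (regGram σ α ℓ (Fin.snoc p z : Fin (n + 1) → E d)) = regGram σ α ℓ p := by
  rw [lead_regGram]
  simp

lemma lastCol_regGram_snoc (ℓ : Fin d → ℝ) (p : Fin n → E d) (z : E d) :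
    lastCol (regGram σ α ℓ (Fin.snoc p z : Fin (n + 1) → E d)) = kvec ℓ p z := by
  rw [lastCol_regGram]
  simp

lemma regGram_hadamard_corr {θ θ' : Fin d → ℝ} (hθ : ∀ i, 0 < θ i) (hle : ∀ i, θ i ≤ θ' i)
    (p : Fin n → E d) : regGram σ α θ' p ⊙ corr θ θ' p = regGram σ α θ p := by
  rw [regGram, Matrix.add_hadamard, gram_hadamard_corr hθ hle, regGram]
  congr 1
  ext i j
  by_cases h : i = j
  · subst h
    simp [corr_self]
  · simp [h]

/-- The variance is a Schur complement minus `σ²/α`, and passing to shorter lengthscales is a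
Hadamard product with a correlation matrix, to which `schur_le_schur_hadamard` applies. -/
lemma postVar_anti (hσ : 0 < σ) (hα : 0 < α) {θ θ' : Fin d → ℝ} (hθ : ∀ i, 0 < θ i)
    (hle : ∀ i, θ i ≤ θ' i) (p : Fin n → E d) (z : E d) :
    postVar σ α θ' p z ≤ postVar σ α θ p z := by
  have h := schur_le_schur_hadamard (posDef_regGram hσ hα θ' (Fin.snoc p z : Fin (n + 1) → E d))
    (C := corr θ θ' (Fin.snoc p z : Fin (n + 1) → E d))
    (by rw [regGram_hadamard_corr hθ hle]; exact posDef_regGram hσ hα _ _)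
    (posSemidef_corr _ _ _) (corr_self _ _ _ _)
  rw [regGram_hadamard_corr hθ hle, schur_regGram_snoc, schur_regGram_snoc] at h
  linarith

lemma postVar_le_one (hσ : 0 < σ) (hα : 0 < α) (ℓ : Fin d → ℝ) (p : Fin n → E d) (z : E d) :
    postVar σ α ℓ p z ≤ 1 := by
  rw [postVar, seKernel_self]
  have := quad_nonneg (posDef_regGram hσ hα ℓ p).inv.posSemidef (kvec ℓ p z)
  rw [regGram] at this
  linarith

/-- The least favourable case is the constant kernel `1`, where all observations are taken at
effectively the same point. Any kernel with unit diagonal is its Hadamard multiple, and its own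
posterior variance is computed explicitly. -/
lemma le_postVar (hσ : 0 < σ) (hα : 0 < α) (ℓ : Fin d → ℝ) (p : Fin n → E d) (z : E d) :
    σ ^ 2 / (α * n + σ ^ 2) ≤ postVar σ α ℓ p z := by
  set c := σ ^ 2 / α with hc
  have hc0 : 0 < c := by positivity
  have hMpos : ∀ k : ℕ, ((Matrix.of fun _ _ : Fin k => (1 : ℝ)) + c • 1).PosDef := fun k =>
    posDef_of_sub_smul_one hc0 (by rw [add_sub_cancel_right]; exact posSemidef_ones)
  set M : Matrix (Fin (n + 1)) (Fin (n + 1)) ℝ := (Matrix.of fun _ _ => (1 : ℝ)) + c • 1 with hM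
  set q : Fin (n + 1) → E d := Fin.snoc p z with hq
  have hMG : M ⊙ gram ℓ q = regGram σ α ℓ q := by
    rw [hM, Matrix.add_hadamard, regGram]
    congr 1
    · ext i j
      simp
    · ext i j
      by_cases h : i = j
      · subst h
        simp [gram, seKernel_self, hc]
      · simp [h]
  have h := schur_le_schur_hadamard (hMpos (n + 1)) (C := gram ℓ q)
    (by rw [← hM, hMG]; exact posDef_regGram hσ hα _ _) (posSemidef_gram _ _)
    (by simp [gram, seKernel_self])
  rw [← hM, hMG, hq, schur_regGram_snoc] at h
  have hlead : lead M = (Matrix.of fun _ _ : Fin n => (1 : ℝ)) + c • 1 := by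
    ext i j
    simp [lead, hM, Matrix.one_apply]
  have hcol : lastCol M = fun _ => (1 : ℝ) := by
    ext i
    simp [lastCol, hM, (Fin.castSucc_lt_last i).ne]
  have hinv : (lead M)⁻¹ *ᵥ lastCol M = fun _ => 1 / (n + c) := by
    rw [hlead]
    have : lastCol M = ((Matrix.of fun _ _ : Fin n => (1 : ℝ)) + c • 1) *ᵥ
        (fun _ => 1 / (n + c)) := by
      rw [hcol]
      ext i
      simp only [Matrix.add_mulVec, Matrix.smul_mulVec, Matrix.one_mulVec]
      simp only [Matrix.mulVec, dotProduct, Pi.add_apply, Matrix.of_apply, Finset.sum_const,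
        Finset.card_univ, Fintype.card_fin, Pi.smul_apply, smul_eq_mul, nsmul_eq_mul]
      field_simp
    rw [this, inv_mulVec_mulVec (hMpos n)]
  have hs : schur M = 1 + c - n / (n + c) := by
    rw [schur, hinv, hcol]
    simp [dotProduct, hM, div_eq_mul_inv]
  have : σ ^ 2 / (α * n + σ ^ 2) = 1 - n / (n + c) := by
    rw [hc]
    field_simp
    ring
  rw [this]
  linarith

lemma postVar_pos (hσ : 0 < σ) (hα : 0 < α) (ℓ : Fin d → ℝ) (p : Fin n → E d) (z : E d) :
    0 < postVar σ α ℓ p z :=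
  lt_of_lt_of_le (by positivity) (le_postVar hσ hα ℓ p z)

/-- Information gain `(1/2) log det (I + α σ⁻² K)` of a design. -/
def infoGain (σ α : ℝ) (ℓ : Fin d → ℝ) (p : Fin n → E d) : ℝ :=
  (1 / 2) * Real.log (1 + (α / σ ^ 2) • gram ℓ p).det

lemma det_infoMatrix (hσ : 0 < σ) (hα : 0 < α) (ℓ : Fin d → ℝ) (p : Fin n → E d) :
    (1 + (α / σ ^ 2) • gram ℓ p).det = (α / σ ^ 2) ^ n * (regGram σ α ℓ p).det := by
  have : 1 + (α / σ ^ 2) • gram ℓ p = (α / σ ^ 2) • regGram σ α ℓ p := by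
    rw [regGram, smul_add, smul_smul, add_comm, div_mul_div_cancel₀ (by positivity),
      div_self hα.ne', one_smul]
  rw [this, Matrix.det_smul, Fintype.card_fin]

/-- Chain rule of information: the determinant factors through the Schur complement, which is the
predictive variance. -/
lemma infoGain_succ (hσ : 0 < σ) (hα : 0 < α) (ℓ : Fin d → ℝ) (p : Fin (n + 1) → E d) :
    infoGain σ α ℓ p = infoGain σ α ℓ (fun i => p i.castSucc) +
      (1 / 2) * Real.log (1 + α / σ ^ 2 *
        postVar σ α ℓ (fun i => p i.castSucc) (p (Fin.last n))) := by
  have hv := postVar_pos hσ hα ℓ (fun i => p i.castSucc) (p (Fin.last n))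
  have hd := (posDef_regGram hσ hα ℓ (fun i => p i.castSucc)).det_pos
  rw [infoGain, infoGain, det_infoMatrix hσ hα, det_infoMatrix hσ hα,
    det_eq_det_lead_mul_schur (posDef_regGram hσ hα ℓ p), lead_regGram, schur_regGram, ← mul_add,
    ← Real.log_mul (by positivity) (by positivity)]
  congr 2
  rw [pow_succ]
  field_simp
  ring

lemma infoGain_zero (ℓ : Fin d → ℝ) (p : Fin 0 → E d) : infoGain σ α ℓ p = 0 := by
  simp [infoGain]

lemma infoGain_nonneg (hσ : 0 < σ) (hα : 0 < α) (ℓ : Fin d → ℝ) (p : Fin n → E d) :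
    0 ≤ infoGain σ α ℓ p := by
  induction n with
  | zero => rw [infoGain_zero]
  | succ n ih =>
    rw [infoGain_succ hσ hα]
    have hv := postVar_pos hσ hα ℓ (fun i => p i.castSucc) (p (Fin.last n))
    have : 0 ≤ Real.log (1 + α / σ ^ 2 *
        postVar σ α ℓ (fun i => p i.castSucc) (p (Fin.last n))) :=
      Real.log_nonneg (by
        have : 0 ≤ α / σ ^ 2 * postVar σ α ℓ (fun i => p i.castSucc) (p (Fin.last n)) := by
          positivity
        linarith)
    have := ih (fun i => p i.castSucc)
    linarith

lemma infoGain_le (hσ : 0 < σ) (hα : 0 < α) (ℓ : Fin d → ℝ) (p : Fin n → E d) :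
    infoGain σ α ℓ p ≤ n * ((1 / 2) * Real.log (1 + α / σ ^ 2)) := by
  induction n with
  | zero => rw [infoGain_zero]; simp
  | succ n ih =>
    rw [infoGain_succ hσ hα]
    have hv := postVar_pos hσ hα ℓ (fun i => p i.castSucc) (p (Fin.last n))
    have hv1 := postVar_le_one hσ hα ℓ (fun i => p i.castSucc) (p (Fin.last n))
    have : Real.log (1 + α / σ ^ 2 * postVar σ α ℓ (fun i => p i.castSucc) (p (Fin.last n))) ≤
        Real.log (1 + α / σ ^ 2) := by
      refine Real.log_le_log (by positivity) ?_
      have : α / σ ^ 2 * postVar σ α ℓ (fun i => p i.castSucc) (p (Fin.last n)) ≤ α / σ ^ 2 :=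
        mul_le_of_le_one_right (by positivity) hv1
      linarith
    have := ih (fun i => p i.castSucc)
    push_cast
    linarith

lemma infoGain_anti (hσ : 0 < σ) (hα : 0 < α) {θ θ' : Fin d → ℝ} (hθ : ∀ i, 0 < θ i)
    (hle : ∀ i, θ i ≤ θ' i) (p : Fin n → E d) : infoGain σ α θ' p ≤ infoGain σ α θ p := by
  induction n with
  | zero => rw [infoGain_zero, infoGain_zero]
  | succ n ih =>
    rw [infoGain_succ hσ hα, infoGain_succ hσ hα]
    have hv := postVar_pos hσ hα θ' (fun i => p i.castSucc) (p (Fin.last n))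
    have hv1 := postVar_anti hσ hα hθ hle (fun i => p i.castSucc) (p (Fin.last n))
    have : Real.log (1 + α / σ ^ 2 * postVar σ α θ' (fun i => p i.castSucc) (p (Fin.last n))) ≤
        Real.log (1 + α / σ ^ 2 * postVar σ α θ (fun i => p i.castSucc) (p (Fin.last n))) := by
      refine Real.log_le_log (by positivity) ?_
      gcongr
    have := ih (fun i => p i.castSucc)
    linarith

variable {X : Set (E d)}

/-- Makes the real supremum in `maxInfoGain` genuine: an unbounded one would take the default value
`0`. -/
lemma bddAbove_infoGain (hσ : 0 < σ) (hα : 0 < α) (X : Set (E d)) (ℓ : Fin d → ℝ) (t : ℕ) :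
    BddAbove (Set.range fun A : Fin t → X => infoGain σ α ℓ fun i => (A i : E d)) :=
  ⟨_, by rintro _ ⟨A, rfl⟩; exact infoGain_le hσ hα ℓ _⟩

lemma infoGain_le_maxInfoGain (hσ : 0 < σ) (hα : 0 < α) (ℓ : Fin d → ℝ) {t : ℕ} (A : Fin t → X) :
    infoGain σ α ℓ (fun i => (A i : E d)) ≤ maxInfoGain X σ α ℓ t :=
  le_ciSup (bddAbove_infoGain hσ hα X ℓ t) A

lemma maxInfoGain_nonneg (hσ : 0 < σ) (hα : 0 < α) (ℓ : Fin d → ℝ) (t : ℕ) :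
    0 ≤ maxInfoGain X σ α ℓ t :=
  Real.iSup_nonneg fun A => infoGain_nonneg hσ hα ℓ fun i => (A i : E d)

lemma maxInfoGain_anti [Nonempty X] (hσ : 0 < σ) (hα : 0 < α) {θ θ' : Fin d → ℝ}
    (hθ : ∀ i, 0 < θ i) (hle : ∀ i, θ i ≤ θ' i) (t : ℕ) :
    maxInfoGain X σ α θ' t ≤ maxInfoGain X σ α θ t :=
  ciSup_le fun A => (infoGain_anti hσ hα hθ hle _).trans (infoGain_le_maxInfoGain hσ hα θ A)

lemma maxInfoGain_mono [Nonempty X] (hσ : 0 < σ) (hα : 0 < α) (ℓ : Fin d → ℝ) :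
    Monotone (maxInfoGain X σ α ℓ) := by
  refine monotone_nat_of_le_succ fun t => ciSup_le fun A => ?_
  set A' : Fin (t + 1) → X := Fin.snoc A (Classical.arbitrary X) with hA'
  refine le_trans ?_ (infoGain_le_maxInfoGain hσ hα ℓ A')
  rw [infoGain_succ hσ hα]
  have hv := postVar_pos hσ hα ℓ (fun i : Fin t => (A' i.castSucc : E d)) (A' (Fin.last t))
  have h1 : 0 ≤ Real.log (1 + α / σ ^ 2 *
      postVar σ α ℓ (fun i : Fin t => (A' i.castSucc : E d)) (A' (Fin.last t))) :=
    Real.log_nonneg (by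
      have : 0 ≤ α / σ ^ 2 *
        postVar σ α ℓ (fun i : Fin t => (A' i.castSucc : E d)) (A' (Fin.last t)) := by positivity
      linarith)
  have h2 : (fun i : Fin t => (A' i.castSucc : E d)) = fun i => (A i : E d) := by
    ext i
    simp [hA']
  rw [h2] at h1 ⊢
  change infoGain σ α ℓ (fun i => (A i : E d)) ≤ _
  linarith

lemma mWidth_le_mWidth [Nonempty X] (hσ : 0 < σ) (hα : 0 < α) {δ : ℝ} (hδ : 0 < δ)
    {θ θ' : Fin d → ℝ} (hθ : ∀ i, 0 < θ i) (hle : ∀ i, θ i ≤ θ' i) {t T : ℕ} (ht : 1 ≤ t)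
    (htT : t ≤ T) : mWidth X σ α δ θ' t ≤ mWidth X σ α δ θ T := by
  have h1 := (maxInfoGain_anti (X := X) hσ hα hθ hle (t - 1)).trans
    (maxInfoGain_mono hσ hα θ (Nat.sub_le_sub_right htT 1))
  have ht0 : (0 : ℝ) < t := by exact_mod_cast ht
  have htT' : (t : ℝ) ≤ T := by exact_mod_cast htT
  unfold mWidth
  gcongr

/-- Sum of the posterior variances along a sequence of queries. -/
lemma sum_postVar_le (hσ : 0 < σ) (hα : 0 < α) (hα1 : α ≤ 1) (ℓ : Fin d → ℝ) (q : ℕ → E d)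
    (T : ℕ) :
    ∑ t ∈ Finset.range T, postVar σ α ℓ (fun i : Fin t => q i) (q t) ≤
      2 / (α * Real.log (1 + 1 / σ ^ 2)) * infoGain σ α ℓ (fun i : Fin T => q i) := by
  have hlog : 0 < Real.log (1 + 1 / σ ^ 2) := Real.log_pos (by
    have : 0 < 1 / σ ^ 2 := by positivity
    linarith)
  induction T with
  | zero => simp [infoGain_zero]
  | succ T ih =>
    rw [Finset.sum_range_succ, infoGain_succ hσ hα]
    simp only [Fin.val_castSucc, Fin.val_last]
    set v := postVar σ α ℓ (fun i : Fin T => q i) (q T) with hv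
    have hv0 : 0 < v := postVar_pos hσ hα ℓ _ _
    have hv1 : v ≤ 1 := postVar_le_one hσ hα ℓ _ _
    -- Bernoulli's inequality with exponent `α v ≤ 1`; this is where `α ≤ 1` enters, and it keeps
    -- the logarithm in the constant free of `α`.
    have hconc : α * v * Real.log (1 + 1 / σ ^ 2) ≤ Real.log (1 + α / σ ^ 2 * v) := by
      rw [← Real.log_rpow (by positivity)]
      refine Real.log_le_log (by positivity) ?_
      have := rpow_one_add_le_one_add_mul_self (s := 1 / σ ^ 2) (p := α * v)
        (by have : 0 < 1 / σ ^ 2 := by positivity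
            linarith) (by positivity) (mul_le_one₀ hα1 hv0.le hv1)
      refine this.trans (le_of_eq ?_)
      ring
    have h2 : v ≤ 2 / (α * Real.log (1 + 1 / σ ^ 2)) *
        (1 / 2 * Real.log (1 + α / σ ^ 2 * v)) := by
      rw [div_mul_eq_mul_div, le_div_iff₀ (by positivity)]
      linarith
    rw [mul_add]
    linarith

lemma noise_regression_le (hσ : 0 < σ) (hα : 0 < α) (ℓ : Fin d → ℝ) (p : Fin n → E d)
    (y : Fin n → ℝ) (z : E d) :
    postMean σ α ℓ p y z ^ 2 ≤ postVar σ α ℓ p z *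
      ((y ⬝ᵥ y - σ ^ 2 / α * (y ⬝ᵥ ((regGram σ α ℓ p)⁻¹ *ᵥ y))) / (σ ^ 2 / α)) := by
  have h := sq_regression_le (M := regGram σ α ℓ (Fin.snoc p z : Fin (n + 1) → E d))
    (c := σ ^ 2 / α) (by positivity)
    (by rw [regGram, add_sub_cancel_right]; exact posSemidef_gram _ _)
    (by rw [schur_regGram_snoc]; linarith [postVar_pos hσ hα ℓ p z]) y
  rw [schur_regGram_snoc, lead_regGram_snoc, lastCol_regGram_snoc, add_sub_cancel_right] at h
  exact h

end Posterior

/-! ### Regression bias of an RKHS function under misspecified lengthscales. -/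

section Bias

variable {d n : ℕ} {σ α : ℝ} {X : Set (E d)}
  {H : Type*} [NormedAddCommGroup H] [InnerProductSpace ℝ H] [CompleteSpace H] [RKHS ℝ H X ℝ]

lemma norm_sq_sum_kerFun {ℓ : Fin d → ℝ}
    (hk : ∀ z z' : X, RKHS.kernel H z z' (1 : ℝ) = seKernel ℓ z z') (q : Fin n → X)
    (v : Fin n → ℝ) :
    ‖∑ i, v i • RKHS.kerFun H (q i) (1 : ℝ)‖ ^ 2 = v ⬝ᵥ (gram ℓ (fun i => (q i : E d)) *ᵥ v) := by
  rw [← real_inner_self_eq_norm_sq, sum_inner]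
  simp only [dotProduct, Matrix.mulVec, inner_sum, Finset.mul_sum]
  refine Finset.sum_congr rfl fun i _ => Finset.sum_congr rfl fun j _ => ?_
  rw [real_inner_smul_left, real_inner_smul_right, RKHS.kerFun_inner, RKHS.kerFun_apply, hk]
  simp only [gram, Matrix.of_apply, RCLike.inner_apply, conj_trivial, mul_one]
  ring

lemma inner_sum_kerFun (f : H) (q : Fin n → X) (v : Fin n → ℝ) :
    inner ℝ (∑ i, v i • RKHS.kerFun H (q i) (1 : ℝ)) f = ∑ i, v i * f (q i) := by
  rw [sum_inner]
  refine Finset.sum_congr rfl fun i _ => ?_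
  rw [real_inner_smul_left, RKHS.kerFun_inner]
  simp

/-- The bias is the inner product of `f` with a combination of kernel sections whose coefficients
`v` are those minimizing the regularized form for `θ`. Its norm, taken with kernel `θU`, is compared
with the form for `θ` by `posSemidef_gram_sub`. -/
lemma regression_bias_le (hσ : 0 < σ) (hα : 0 < α) {θ θL θU : Fin d → ℝ} (hθL : ∀ i, 0 < θL i)
    (hLθ : ∀ i, θL i ≤ θ i) (hθU : ∀ i, θ i ≤ θU i)
    (hk : ∀ z z' : X, RKHS.kernel H z z' (1 : ℝ) = seKernel θU z z') (f : H) (p : Fin n → X)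
    (z : X) :
    |f z - postMean σ α θ (fun i => (p i : E d)) (fun i => f (p i)) z| ≤
      Real.sqrt (lengthscaleRatio θL θU) * ‖f‖ *
        postStd σ α θ (fun i => (p i : E d)) z := by
  have hθ : ∀ i, 0 < θ i := fun i => (hθL i).trans_le (hLθ i)
  set P : Fin n → E d := fun i => (p i : E d) with hP
  set q : Fin (n + 1) → X := Fin.snoc p z with hq
  have hqP : (fun i => (q i : E d)) = (Fin.snoc P z : Fin (n + 1) → E d) := by
    ext i
    refine Fin.lastCases ?_ (fun i => ?_) i <;> simp [hq, hP]
  set w := (regGram σ α θ P)⁻¹ *ᵥ kvec θ P z with hw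
  set v : Fin (n + 1) → ℝ := Fin.snoc (-w) 1 with hv
  have hpd := posDef_regGram hσ hα θ (Fin.snoc P z : Fin (n + 1) → E d)
  have hmean : f z - postMean σ α θ P (fun i => f (p i)) z =
      inner ℝ (∑ i, v i • RKHS.kerFun H (q i) (1 : ℝ)) f := by
    rw [inner_sum_kerFun, Fin.sum_univ_castSucc, postMean]
    have : kvec θ P z ⬝ᵥ ((regGram σ α θ P)⁻¹ *ᵥ fun i => f (p i)) = w ⬝ᵥ fun i => f (p i) := by
      rw [dotProduct_mulVec_symm (posDef_regGram hσ hα θ P).inv.isHermitian, dotProduct_comm]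
    rw [regGram] at this
    rw [this]
    simp [hv, hq, dotProduct]
    ring
  have hsch : v ⬝ᵥ (regGram σ α θ (Fin.snoc P z : Fin (n + 1) → E d) *ᵥ v) =
      postVar σ α θ P z + σ ^ 2 / α := by
    rw [← schur_regGram_snoc, schur_eq_quad hpd, lead_regGram_snoc, lastCol_regGram_snoc]
  -- The ridge part of the form is at least `σ²/α`, which cancels the noise variance in the Schur
  -- complement and leaves `postVar` alone.
  have hvv : 1 ≤ v ⬝ᵥ v := by
    rw [hv, snoc_dotProduct_snoc]
    have : 0 ≤ -w ⬝ᵥ -w := by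
      simp only [dotProduct]
      exact Finset.sum_nonneg fun i _ => mul_self_nonneg _
    linarith
  have hgram : v ⬝ᵥ (gram θ (Fin.snoc P z : Fin (n + 1) → E d) *ᵥ v) ≤ postVar σ α θ P z := by
    rw [regGram, Matrix.add_mulVec, dotProduct_add, Matrix.smul_mulVec, Matrix.one_mulVec,
      dotProduct_smul, smul_eq_mul] at hsch
    have : σ ^ 2 / α * 1 ≤ σ ^ 2 / α * (v ⬝ᵥ v) := by gcongr
    linarith
  have hcomp := quad_nonneg (posSemidef_gram_sub hθ hθU (Fin.snoc P z : Fin (n + 1) → E d)) v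
  rw [Matrix.sub_mulVec, dotProduct_sub, Matrix.smul_mulVec, dotProduct_smul, smul_eq_mul] at hcomp
  have hratio : ∏ i, θU i / θ i ≤ lengthscaleRatio θL θU := by
    refine Finset.prod_le_prod (fun i _ => div_nonneg ((hθ i).le.trans (hθU i)) (hθ i).le)
      fun i _ => ?_
    have := hθL i
    have := hLθ i
    have := (hθ i).le.trans (hθU i)
    gcongr
  have hpv := postVar_pos hσ hα θ P z
  have hratio0 : 0 ≤ ∏ i, θU i / θ i :=
    Finset.prod_nonneg fun i _ => div_nonneg ((hθ i).le.trans (hθU i)) (hθ i).le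
  have hnorm : ‖∑ i, v i • RKHS.kerFun H (q i) (1 : ℝ)‖ ≤
      Real.sqrt (lengthscaleRatio θL θU) * postStd σ α θ P z := by
    rw [postStd, ← Real.sqrt_mul (hratio0.trans hratio)]
    refine Real.le_sqrt_of_sq_le ?_
    rw [norm_sq_sum_kerFun hk, hqP]
    calc _ ≤ (∏ i, θU i / θ i) * (v ⬝ᵥ (gram θ (Fin.snoc P z : Fin (n + 1) → E d) *ᵥ v)) := by
          linarith
      _ ≤ (∏ i, θU i / θ i) * postVar σ α θ P z := by gcongr
      _ ≤ _ := by gcongr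
  rw [hmean]
  calc _ ≤ ‖∑ i, v i • RKHS.kerFun H (q i) (1 : ℝ)‖ * ‖f‖ := abs_real_inner_le_norm _ _
    _ ≤ Real.sqrt (lengthscaleRatio θL θU) * postStd σ α θ P z * ‖f‖ := by gcongr
    _ = _ := by ring

lemma postMean_add (ℓ : Fin d → ℝ) (p : Fin n → E d) (y y' : Fin n → ℝ) (z : E d) :
    postMean σ α ℓ p (fun i => y i + y' i) z = postMean σ α ℓ p y z + postMean σ α ℓ p y' z := by
  have : (fun i => y i + y' i) = y + y' := rfl
  rw [postMean, this, Matrix.mulVec_add, dotProduct_add, postMean, postMean]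

end Bias

/-! ### Continuity in design and data, used for measurability. -/

section Continuity

variable {d n : ℕ} {σ α : ℝ}

lemma continuous_seKernel {Z : Type*} [TopologicalSpace Z] (ℓ : Fin d → ℝ) {a b : Z → E d}
    (ha : Continuous a) (hb : Continuous b) : Continuous fun q => seKernel ℓ (a q) (b q) := by
  unfold seKernel
  fun_prop

lemma continuous_regGram (ℓ : Fin d → ℝ) :
    Continuous fun p : Fin n → E d => regGram σ α ℓ p := by
  refine Continuous.add (continuous_matrix fun i j => ?_) continuous_const
  exact continuous_seKernel ℓ (continuous_apply i) (continuous_apply j)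

lemma continuous_regGram_inv (hσ : 0 < σ) (hα : 0 < α) (ℓ : Fin d → ℝ) :
    Continuous fun p : Fin n → E d => (regGram σ α ℓ p)⁻¹ := by
  simp_rw [Matrix.inv_def, Ring.inverse_eq_inv']
  have h := continuous_regGram (σ := σ) (α := α) (n := n) ℓ
  exact (h.matrix_det.inv₀ fun p => (posDef_regGram hσ hα ℓ p).det_pos.ne').smul h.matrix_adjugate

lemma continuous_kvec (ℓ : Fin d → ℝ) :
    Continuous fun q : (Fin n → E d) × E d => kvec ℓ q.1 q.2 := by
  refine continuous_pi fun i => ?_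
  exact continuous_seKernel ℓ ((continuous_apply i).comp continuous_fst) continuous_snd

lemma continuous_postMean (hσ : 0 < σ) (hα : 0 < α) (ℓ : Fin d → ℝ) :
    Continuous fun q : (Fin n → E d) × (Fin n → ℝ) × E d => postMean σ α ℓ q.1 q.2.1 q.2.2 := by
  have h1 := (continuous_kvec (n := n) ℓ).comp
    (by fun_prop : Continuous fun q : (Fin n → E d) × (Fin n → ℝ) × E d => (q.1, q.2.2))
  have h2 := (continuous_regGram_inv (n := n) hσ hα ℓ).comp
    (by fun_prop : Continuous fun q : (Fin n → E d) × (Fin n → ℝ) × E d => q.1)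
  exact h1.dotProduct (h2.matrix_mulVec (by fun_prop))

lemma continuous_postVar (hσ : 0 < σ) (hα : 0 < α) (ℓ : Fin d → ℝ) :
    Continuous fun q : (Fin n → E d) × E d => postVar σ α ℓ q.1 q.2 := by
  have h1 := continuous_kvec (n := n) ℓ
  have h2 := (continuous_regGram_inv (n := n) hσ hα ℓ).comp
    (by fun_prop : Continuous fun q : (Fin n → E d) × E d => q.1)
  refine Continuous.sub ?_ (h1.dotProduct (h2.matrix_mulVec h1))
  exact continuous_seKernel ℓ continuous_snd continuous_snd

end Continuity

/-! ### The function `τ_g`: monotonicity, range, power mean inequality, value at zero. -/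

section Tau

open Filter Topology

variable {g : ℝ}

/-- An integral over a fixed domain against a probability measure, which is the form needed for
dominated convergence and Jensen's inequality. -/
lemma tau_eq_integral (hg : 1 ≤ g) (v : ℝ) :
    tau g v = ∫ u, max (u - v) 0 ^ g ∂gaussianReal 0 1 := by
  rw [integral_gaussianReal_eq_integral_smul one_ne_zero, tau, ← integral_indicator measurableSet_Ioi]
  refine integral_congr_ae (ae_of_all _ fun u => ?_)
  by_cases h : v < u
  · simp only [Set.indicator, Set.mem_Ioi, h, if_true, smul_eq_mul]
    rw [max_eq_left (by linarith), mul_comm]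
  · simp only [Set.indicator, Set.mem_Ioi, h, if_false, smul_eq_mul]
    rw [max_eq_right (by linarith), Real.zero_rpow (by linarith), mul_zero]

lemma integrable_abs_add_rpow (hg : 1 ≤ g) (R : ℝ) :
    Integrable (fun u => |(|u| + R)| ^ g) (gaussianReal 0 1) := by
  have h1 : MemLp (fun u : ℝ => |u| + R) (ENNReal.ofReal g) (gaussianReal 0 1) :=
    (memLp_id_gaussianReal' _ ENNReal.ofReal_ne_top).abs.add (memLp_const R)
  have := h1.integrable_norm_rpow (by simpa using by linarith) ENNReal.ofReal_ne_top
  simpa [ENNReal.toReal_ofReal (by linarith : 0 ≤ g)] using this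

lemma max_rpow_le (hg : 1 ≤ g) {R v : ℝ} (hv : -R ≤ v) (u : ℝ) :
    max (u - v) 0 ^ g ≤ |(|u| + R)| ^ g := by
  refine Real.rpow_le_rpow (le_max_right _ _) (max_le ?_ (abs_nonneg _)) (by linarith)
  calc u - v ≤ |u| + R := by linarith [le_abs_self u]
    _ ≤ _ := le_abs_self _

lemma continuous_max_rpow (hg : 1 ≤ g) : Continuous fun q : ℝ × ℝ => max (q.1 - q.2) 0 ^ g :=
  (by fun_prop : Continuous fun q : ℝ × ℝ => max (q.1 - q.2) 0).rpow_const
    fun _ => Or.inr (by linarith)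

lemma integrable_max_rpow (hg : 1 ≤ g) (v : ℝ) :
    Integrable (fun u => max (u - v) 0 ^ g) (gaussianReal 0 1) := by
  refine (integrable_abs_add_rpow hg |v|).mono'
    ((continuous_max_rpow hg).comp (by fun_prop : Continuous fun u : ℝ => (u, v))).aestronglyMeasurable
    (ae_of_all _ fun u => ?_)
  rw [Real.norm_of_nonneg (Real.rpow_nonneg (le_max_right _ _) _)]
  exact max_rpow_le hg (neg_abs_le v) u

lemma gaussianReal_Ioi_pos (v : ℝ) : 0 < gaussianReal 0 1 (Set.Ioi v) := by
  rw [pos_iff_ne_zero]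
  intro h
  have h2 := gaussianReal_absolutelyContinuous' 0 one_ne_zero h
  simp at h2

lemma strictAnti_tau (hg : 1 ≤ g) : StrictAnti (tau g) := by
  intro v v' hv
  rw [tau_eq_integral hg, tau_eq_integral hg, ← sub_pos,
    ← integral_sub (integrable_max_rpow hg v) (integrable_max_rpow hg v')]
  have hnn : ∀ u : ℝ, 0 ≤ max (u - v) 0 ^ g - max (u - v') 0 ^ g := fun u =>
    sub_nonneg.2 (Real.rpow_le_rpow (le_max_right _ _) (max_le_max (by linarith) le_rfl)
      (by linarith))
  rw [integral_pos_iff_support_of_nonneg hnn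
    ((integrable_max_rpow hg v).sub (integrable_max_rpow hg v'))]
  refine lt_of_lt_of_le (gaussianReal_Ioi_pos v) (measure_mono fun u hu => ?_)
  have hu : v < u := hu
  refine (sub_pos.2 (Real.rpow_lt_rpow (le_max_right _ _) ?_ (by linarith))).ne'
  rw [max_eq_left (by linarith : 0 ≤ u - v)]
  exact max_lt (by linarith) (by linarith)

lemma continuous_tau (hg : 1 ≤ g) : Continuous (tau g) := by
  rw [continuous_iff_continuousAt]
  intro v₀
  rw [show tau g = fun v => ∫ u, max (u - v) 0 ^ g ∂gaussianReal 0 1 from funext (tau_eq_integral hg)]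
  refine continuousAt_of_dominated (bound := fun u => |(|u| + (|v₀| + 1))| ^ g)
    (.of_forall fun v => (integrable_max_rpow hg v).aestronglyMeasurable) ?_
    (integrable_abs_add_rpow hg _) (ae_of_all _ fun u => ?_)
  · filter_upwards [lt_mem_nhds (sub_one_lt v₀)] with v hv
    refine ae_of_all _ fun u => ?_
    rw [Real.norm_of_nonneg (Real.rpow_nonneg (le_max_right _ _) _)]
    exact max_rpow_le hg (by linarith [neg_abs_le v₀]) u
  · exact ((continuous_max_rpow hg).comp (by fun_prop : Continuous fun v : ℝ => (u, v))).continuousAt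

lemma tau_pos (hg : 1 ≤ g) (v : ℝ) : 0 < tau g v := by
  refine lt_of_le_of_lt ?_ (strictAnti_tau hg (lt_add_one v))
  rw [tau_eq_integral hg]
  exact integral_nonneg fun u => Real.rpow_nonneg (le_max_right _ _) _

lemma tendsto_tau_atTop (hg : 1 ≤ g) : Tendsto (tau g) atTop (𝓝 0) := by
  rw [show tau g = fun v => ∫ u, max (u - v) 0 ^ g ∂gaussianReal 0 1 from funext (tau_eq_integral hg)]
  have := tendsto_integral_filter_of_dominated_convergence (μ := gaussianReal 0 1) (l := atTop)
    (F := fun v u : ℝ => max (u - v) 0 ^ g) (f := fun _ => 0)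
    (fun u => |(|u| + 0)| ^ g)
    (.of_forall fun v => (integrable_max_rpow hg v).aestronglyMeasurable) ?_
    (integrable_abs_add_rpow hg _) (ae_of_all _ fun u => ?_)
  · simpa using this
  · filter_upwards [eventually_ge_atTop 0] with v hv
    refine ae_of_all _ fun u => ?_
    rw [Real.norm_of_nonneg (Real.rpow_nonneg (le_max_right _ _) _)]
    exact max_rpow_le hg (by linarith) u
  · refine tendsto_const_nhds.congr' ?_
    filter_upwards [eventually_ge_atTop u] with v hv
    rw [max_eq_right (by linarith), Real.zero_rpow (by linarith)]

/-- Power mean inequality. -/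
lemma tau_one_rpow_le (hg : 1 ≤ g) (v : ℝ) : tau 1 v ^ g ≤ tau g v := by
  have h := (convexOn_rpow hg).map_integral_le (μ := gaussianReal 0 1)
    (f := fun u => max (u - v) 0) (Real.continuous_rpow_const (by linarith)).continuousOn isClosed_Ici
    (ae_of_all _ fun u => Set.mem_Ici.2 (le_max_right _ _)) (by simpa using integrable_max_rpow le_rfl v)
    (integrable_max_rpow hg v)
  rw [tau_eq_integral hg, tau_eq_integral le_rfl]
  simpa using h

lemma neg_le_tau_one (v : ℝ) : -v ≤ tau 1 v := by
  have hid : Integrable (fun u : ℝ => u) (gaussianReal 0 1) :=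
    (memLp_id_gaussianReal' 1 ENNReal.one_ne_top).integrable le_rfl
  have h : ∫ u, (u - v) ∂gaussianReal 0 1 ≤ ∫ u, max (u - v) 0 ^ (1 : ℝ) ∂gaussianReal 0 1 :=
    integral_mono (hid.sub (integrable_const v)) (integrable_max_rpow le_rfl v) fun u => by
      simp
  rw [← tau_eq_integral le_rfl, integral_sub hid (integrable_const v), integral_id_gaussianReal] at h
  simpa using h

lemma range_tau (hg : 1 ≤ g) : Set.range (tau g) = Set.Ioi 0 := by
  refine Set.Subset.antisymm (by rintro _ ⟨v, rfl⟩; exact tau_pos hg v) fun s (hs : 0 < s) => ?_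
  obtain ⟨b, hb⟩ := ((tendsto_tau_atTop hg).eventually (gt_mem_nhds hs)).exists
  -- Large values are reached on the left because `τ_g(-a) ≥ τ_1(-a) ^ g ≥ a ^ g` for `a ≥ 0`.
  have ha : s ≤ tau g (-(s ^ (1 / g))) := by
    refine le_trans ?_ (tau_one_rpow_le hg _)
    have h0 : 0 ≤ s ^ (1 / g) := by positivity
    calc s = (s ^ (1 / g)) ^ g := by
          rw [← Real.rpow_mul hs.le, one_div_mul_cancel (by linarith), Real.rpow_one]
      _ ≤ _ := Real.rpow_le_rpow h0 (by simpa using neg_le_tau_one (-(s ^ (1 / g)))) (by linarith)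
  obtain ⟨c, hc⟩ := mem_range_of_exists_le_of_exists_ge (continuous_tau hg) ⟨b, hb.le⟩ ⟨_, ha⟩
  exact ⟨c, hc⟩

lemma tau_tauInv (hg : 1 ≤ g) {s : ℝ} (hs : 0 < s) : tau g (tauInv g s) = s := by
  refine Function.invFun_eq ?_
  have : s ∈ Set.range (tau g) := by rw [range_tau hg]; exact hs
  exact this

lemma le_tauInv (hg : 1 ≤ g) {s v : ℝ} (hs : 0 < s) (h : s ≤ tau g v) : v ≤ tauInv g s := by
  rwa [← (strictAnti_tau hg).le_iff_ge, tau_tauInv hg hs]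

lemma tauInv_anti (hg : 1 ≤ g) {s s' : ℝ} (hs : 0 < s) (h : s ≤ s') : tauInv g s' ≤ tauInv g s :=
  le_tauInv hg hs (by rwa [tau_tauInv hg (hs.trans_le h)])

lemma tau_zero (hg : 1 ≤ g) : tau g 0 = Cg g := by
  have h := integral_rpow_mul_exp_neg_mul_rpow (p := 2) (q := g) (b := 1 / 2) two_pos
    (by linarith) (by norm_num)
  have h2 : tau g 0 = (Real.sqrt (2 * Real.pi))⁻¹ *
      ∫ x in Set.Ioi (0 : ℝ), x ^ g * Real.exp (-(1 / 2) * x ^ (2 : ℝ)) := by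
    rw [tau, ← integral_const_mul]
    refine setIntegral_congr_fun measurableSet_Ioi fun u _ => ?_
    simp only [gaussianPDFReal, sub_zero, NNReal.coe_one, mul_one, Real.rpow_two]
    ring_nf
  rw [h2, h, Cg]
  have h3 : ((1 : ℝ) / 2) ^ (-(g + 1) / 2) = 2 ^ (g / 2) * Real.sqrt 2 := by
    rw [one_div, Real.inv_rpow two_pos.le, ← Real.rpow_neg two_pos.le, Real.sqrt_eq_rpow,
      ← Real.rpow_add two_pos]
    congr 1
    ring
  rw [h3, Real.sqrt_mul two_pos.le]
  have := Real.sqrt_pos.2 Real.pi_pos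
  field_simp

end Tau

/-! ### Self-normalized noise: likelihood ratios of mean one and Markov bounds. -/

section SelfNormalized

variable {d n : ℕ} {σ α : ℝ}

/-- The quadratic form `yᵀ K (K + (σ²/α) I)⁻¹ y`. -/
def selfNorm (σ α : ℝ) (ℓ : Fin d → ℝ) (p : Fin n → E d) (y : Fin n → ℝ) : ℝ :=
  y ⬝ᵥ y - σ ^ 2 / α * (y ⬝ᵥ ((regGram σ α ℓ p)⁻¹ *ᵥ y))

/-- The increment is the exponent of `densityRatio` for the predictive law of the next observation,
up to the factor `2σ²` and the logarithm of the variance. -/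
lemma selfNorm_snoc (hσ : 0 < σ) (hα : 0 < α) (ℓ : Fin d → ℝ) (p : Fin (n + 1) → E d)
    (y : Fin n → ℝ) (e : ℝ) :
    selfNorm σ α ℓ p (Fin.snoc y e : Fin (n + 1) → ℝ) =
      selfNorm σ α ℓ (fun i => p i.castSucc) y +
        (e ^ 2 - (e - postMean σ α ℓ (fun i => p i.castSucc) y (p (Fin.last n))) ^ 2 /
          (1 + α / σ ^ 2 * postVar σ α ℓ (fun i => p i.castSucc) (p (Fin.last n)))) := by
  have hv := postVar_pos hσ hα ℓ (fun i => p i.castSucc) (p (Fin.last n))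
  rw [selfNorm, inv_quad_snoc (posDef_regGram hσ hα ℓ p), lead_regGram, lastCol_regGram,
    schur_regGram, snoc_dotProduct_snoc, selfNorm]
  change _ - σ ^ 2 / α * (_ + (e - postMean σ α ℓ (fun i => p i.castSucc) y (p (Fin.last n))) ^ 2 / _)
    = _
  field_simp
  ring

lemma continuous_selfNorm (hσ : 0 < σ) (hα : 0 < α) (ℓ : Fin d → ℝ) :
    Continuous fun q : (Fin n → E d) × (Fin n → ℝ) => selfNorm σ α ℓ q.1 q.2 := by
  have h1 := (continuous_regGram_inv (n := n) hσ hα ℓ).comp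
    (continuous_fst : Continuous fun q : (Fin n → E d) × (Fin n → ℝ) => q.1)
  exact (continuous_snd.dotProduct continuous_snd).sub
    (continuous_const.mul (continuous_snd.dotProduct (h1.matrix_mulVec continuous_snd)))

lemma continuous_infoGain (hσ : 0 < σ) (hα : 0 < α) (ℓ : Fin d → ℝ) :
    Continuous fun p : Fin n → E d => infoGain σ α ℓ p := by
  refine continuous_const.mul (Continuous.log ?_ fun p => ?_)
  · simp_rw [det_infoMatrix hσ hα]
    exact continuous_const.mul (continuous_regGram ℓ).matrix_det
  · rw [det_infoMatrix hσ hα]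
    exact (mul_pos (by positivity) (posDef_regGram hσ hα ℓ p).det_pos).ne'

lemma measurable_of_continuous_pair {A B C Z : Type*} [TopologicalSpace A] [TopologicalSpace B]
    [MeasurableSpace A] [MeasurableSpace B] [BorelSpace A] [BorelSpace B]
    [SecondCountableTopology A] [SecondCountableTopology B] [TopologicalSpace C]
    [MeasurableSpace C] [BorelSpace C] {mZ : MeasurableSpace Z} {F : A × B → C}
    (hF : Continuous F) {a : Z → A} {b : Z → B} (ha : Measurable a) (hb : Measurable b) :
    Measurable fun w => F (a w, b w) :=
  hF.measurable.comp (ha.prodMk hb)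

lemma measurable_postMean (hσ : 0 < σ) (hα : 0 < α) (ℓ : Fin d → ℝ) {Z : Type*}
    {mZ : MeasurableSpace Z} {a : Z → Fin n → E d} {b : Z → Fin n → ℝ} {c : Z → E d}
    (ha : Measurable a) (hb : Measurable b) (hc : Measurable c) :
    Measurable fun w => postMean σ α ℓ (a w) (b w) (c w) :=
  measurable_of_continuous_pair
    (F := fun q : (Fin n → E d) × (Fin n → ℝ) × E d => postMean σ α ℓ q.1 q.2.1 q.2.2)
    (b := fun w => (b w, c w)) (continuous_postMean hσ hα ℓ) ha (hb.prodMk hc)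

lemma measurable_postVar (hσ : 0 < σ) (hα : 0 < α) (ℓ : Fin d → ℝ) {Z : Type*}
    {mZ : MeasurableSpace Z} {a : Z → Fin n → E d} {c : Z → E d}
    (ha : Measurable a) (hc : Measurable c) :
    Measurable fun w => postVar σ α ℓ (a w) (c w) :=
  measurable_of_continuous_pair (continuous_postVar hσ hα ℓ) ha hc

/-- Ratio of the densities of `N(m, σ² s)` and `N(0, σ²)`. -/
def densityRatio (σ m s e : ℝ) : ℝ :=
  Real.exp ((e ^ 2 - (e - m) ^ 2 / s) / (2 * σ ^ 2) - (1 / 2) * Real.log s)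

lemma lintegral_densityRatio (hσ : 0 < σ) (m : ℝ) {s : ℝ} (hs : 0 < s) :
    ∫⁻ e, ENNReal.ofReal (densityRatio σ m s e) ∂gaussianReal 0 (Real.toNNReal (σ ^ 2)) = 1 := by
  have hv : Real.toNNReal (σ ^ 2) ≠ 0 := by
    exact (Real.toNNReal_pos.2 (by positivity)).ne'
  have hv' : Real.toNNReal (σ ^ 2 * s) ≠ 0 := by
    exact (Real.toNNReal_pos.2 (by positivity)).ne'
  rw [gaussianReal_of_var_ne_zero _ hv, lintegral_withDensity_eq_lintegral_mul _
    (measurable_gaussianPDF _ _) (by unfold densityRatio; fun_prop),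
    ← lintegral_gaussianPDF_eq_one m hv']
  refine lintegral_congr fun e => ?_
  rw [Pi.mul_apply, gaussianPDF, gaussianPDF, ← ENNReal.ofReal_mul (gaussianPDFReal_nonneg _ _ _)]
  congr 1
  simp only [gaussianPDFReal, densityRatio]
  rw [Real.coe_toNNReal _ (by positivity), Real.coe_toNNReal _ (by positivity)]
  have h1 : (Real.sqrt (2 * Real.pi * (σ ^ 2 * s)))⁻¹ =
      (Real.sqrt (2 * Real.pi * σ ^ 2))⁻¹ * Real.exp (-((1 / 2) * Real.log s)) := by
    rw [← mul_assoc, Real.sqrt_mul (by positivity), mul_inv, Real.exp_neg]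
    congr 2
    rw [one_div, mul_comm, Real.exp_mul, Real.exp_log hs, Real.sqrt_eq_rpow, one_div]
  rw [h1, mul_assoc, mul_assoc _ (Real.exp _), ← Real.exp_add, ← Real.exp_add]
  congr 2
  field_simp
  ring

variable {X : Set (E d)} {Ω : Type*}

/-- The first `n` noise variables. -/
def noise (ε : ℕ → Ω → ℝ) (n : ℕ) (ω : Ω) : Fin n → ℝ := fun i => ε (i + 1) ω

lemma noise_succ (ε : ℕ → Ω → ℝ) (n : ℕ) (ω : Ω) :
    noise ε (n + 1) ω = (Fin.snoc (noise ε n ω) (ε (n + 1) ω) : Fin (n + 1) → ℝ) := by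
  ext i
  refine Fin.lastCases ?_ (fun i => ?_) i <;> simp [noise]

lemma design_succ (x : ℕ → Ω → X) (n : ℕ) (ω : Ω) :
    (fun i : Fin n => design x (n + 1) ω i.castSucc) = design x n ω := rfl

/-- Density ratio of the observed noise under the prior with kernel `ℓ` and under pure noise. -/
def likelihoodRatio (σ α : ℝ) (ℓ : Fin d → ℝ) (p : Fin n → E d) (y : Fin n → ℝ) : ℝ :=
  Real.exp (selfNorm σ α ℓ p y / (2 * σ ^ 2) - infoGain σ α ℓ p)

lemma measurable_likelihoodRatio (hσ : 0 < σ) (hα : 0 < α) (ℓ : Fin d → ℝ) {Z : Type*}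
    {mZ : MeasurableSpace Z} {a : Z → Fin n → E d} {b : Z → Fin n → ℝ}
    (ha : Measurable a) (hb : Measurable b) :
    Measurable fun w => likelihoodRatio σ α ℓ (a w) (b w) := by
  have h1 := measurable_of_continuous_pair (continuous_selfNorm (n := n) hσ hα ℓ) ha hb
  have h2 := (continuous_infoGain (n := n) hσ hα ℓ).measurable.comp ha
  exact Real.measurable_exp.comp ((h1.div_const _).sub h2)

variable {mΩ : MeasurableSpace Ω} {P : Measure Ω} [IsProbabilityMeasure P] {g : ℝ} {f : X → ℝ}
  {ℱ : Filtration ℕ mΩ} {ε : ℕ → Ω → ℝ} {θ : ℕ → Ω → Fin d → ℝ} {ν : ℕ → Ω → ℝ} {x : ℕ → Ω → X}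

omit [IsProbabilityMeasure P] in
lemma IsRun.measurable_query (h : IsRun P σ α g f ℱ ε θ ν x) {k m : ℕ} (hk : k ≤ m) :
    Measurable[ℱ m] fun ω => (x (k + 1) ω : E d) :=
  measurable_subtype_coe.comp ((h.query_measurable k).mono (ℱ.mono hk) le_rfl)

omit [IsProbabilityMeasure P] in
lemma IsRun.measurable_design (h : IsRun P σ α g f ℱ ε θ ν x) (n : ℕ) :
    Measurable[ℱ n] (design x n) :=
  @measurable_pi_lambda _ _ _ (ℱ n) _ _ fun i => h.measurable_query i.2.le

omit [IsProbabilityMeasure P] in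
lemma IsRun.measurable_noise (h : IsRun P σ α g f ℱ ε θ ν x) (n : ℕ) :
    Measurable[ℱ n] (noise ε n) :=
  @measurable_pi_lambda _ _ _ (ℱ n) _ _ fun i =>
    (h.noise_measurable i).mono (ℱ.mono i.2) le_rfl

/-- Martingale argument: each round multiplies the ratio by a density ratio whose predictive mean
and variance are known before the noise, and which integrates to one against the law of the noise.
The kernel `ℓ` has to be deterministic here. -/
lemma IsRun.lintegral_likelihoodRatio (h : IsRun P σ α g f ℱ ε θ ν x) (hσ : 0 < σ) (hα : 0 < α)
    (ℓ : Fin d → ℝ) (n : ℕ) :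
    ∫⁻ ω, ENNReal.ofReal (likelihoodRatio σ α ℓ (design x n ω) (noise ε n ω)) ∂P = 1 := by
  induction n with
  | zero => simp [likelihoodRatio, selfNorm, infoGain_zero]
  | succ n ih =>
    set m : Ω → ℝ := fun ω => postMean σ α ℓ (design x n ω) (noise ε n ω) (x (n + 1) ω) with hm
    set s : Ω → ℝ := fun ω => 1 + α / σ ^ 2 * postVar σ α ℓ (design x n ω) (x (n + 1) ω) with hs
    set Z : Ω → ℝ := fun ω => likelihoodRatio σ α ℓ (design x n ω) (noise ε n ω) with hZ
    have hs0 : ∀ ω, 0 < s ω := fun ω => by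
      have := postVar_pos hσ hα ℓ (design x n ω) (x (n + 1) ω)
      simp only [hs]
      positivity
    have hmm : Measurable[ℱ n] m := measurable_postMean hσ hα ℓ (h.measurable_design n)
      (h.measurable_noise n) (h.measurable_query le_rfl)
    have hmv := measurable_postVar hσ hα ℓ (h.measurable_design n) (h.measurable_query le_rfl)
    have hms : Measurable[ℱ n] s := measurable_const.add (measurable_const.mul hmv)
    have hmZ : Measurable[ℱ n] Z :=
      measurable_likelihoodRatio hσ hα ℓ (h.measurable_design n) (h.measurable_noise n)
    set W : Ω → ℝ × ℝ × ℝ := fun ω => (Z ω, m ω, s ω) with hW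
    have hmW : Measurable[ℱ n] W := hmZ.prodMk (hmm.prodMk hms)
    have hmW' : Measurable W := hmW.mono (ℱ.le n) le_rfl
    have hmε : Measurable (ε (n + 1)) := (h.noise_measurable n).mono (ℱ.le _) le_rfl
    have hind : IndepFun W (ε (n + 1)) P := by
      rw [IndepFun_iff_Indep]
      exact indep_of_indep_of_le_left (h.noise_indep n).symm hmW.comap_le
    have hprod := (indepFun_iff_map_prod_eq_prod_map_map hmW'.aemeasurable hmε.aemeasurable).1 hind
    have hstep : ∀ ω, ENNReal.ofReal (likelihoodRatio σ α ℓ (design x (n + 1) ω)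
        (noise ε (n + 1) ω)) =
        (fun q : (ℝ × ℝ × ℝ) × ℝ => ENNReal.ofReal q.1.1 *
          ENNReal.ofReal (densityRatio σ q.1.2.1 q.1.2.2 q.2)) (W ω, ε (n + 1) ω) := by
      intro ω
      simp only [hW]
      rw [← ENNReal.ofReal_mul (show 0 ≤ Z ω from (Real.exp_pos _).le)]
      congr 1
      simp only [hZ, likelihoodRatio, densityRatio]
      rw [← Real.exp_add, noise_succ, selfNorm_snoc hσ hα, infoGain_succ hσ hα, design_succ]
      congr 1
      have hx : design x (n + 1) ω (Fin.last n) = x (n + 1) ω := by simp [design]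
      simp only [hx, hm, hs]
      ring
    have hmF : Measurable fun q : (ℝ × ℝ × ℝ) × ℝ => ENNReal.ofReal q.1.1 *
        ENNReal.ofReal (densityRatio σ q.1.2.1 q.1.2.2 q.2) := by
      unfold densityRatio
      fun_prop
    -- By independence the joint law of past and new noise is a product, so the new noise can be
    -- integrated out first.
    rw [lintegral_congr hstep, ← lintegral_map hmF (hmW'.prodMk hmε), hprod,
      lintegral_prod _ hmF.aemeasurable, lintegral_map hmF.lintegral_prod_right' hmW', ← ih]
    refine lintegral_congr fun ω => ?_
    simp only []
    rw [lintegral_const_mul _ (by unfold densityRatio; fun_prop), h.noise_law,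
      lintegral_densityRatio hσ _ (hs0 ω), mul_one]

lemma IsRun.measure_likelihoodRatio_ge (h : IsRun P σ α g f ℱ ε θ ν x) (hσ : 0 < σ) (hα : 0 < α)
    (ℓ : Fin d → ℝ) (n : ℕ) {c : ℝ} (hc : 0 < c) :
    P {ω | c ≤ likelihoodRatio σ α ℓ (design x n ω) (noise ε n ω)} ≤ ENNReal.ofReal (1 / c) := by
  have hm : Measurable fun ω => likelihoodRatio σ α ℓ (design x n ω) (noise ε n ω) := by
    exact measurable_likelihoodRatio hσ hα ℓ ((h.measurable_design n).mono (ℱ.le n) le_rfl)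
      ((h.measurable_noise n).mono (ℱ.le n) le_rfl)
  have := meas_ge_le_lintegral_div (μ := P) hm.ennreal_ofReal.aemeasurable
    (ε := ENNReal.ofReal c) (by simpa using hc) ENNReal.ofReal_ne_top
  rw [h.lintegral_likelihoodRatio hσ hα, ← ENNReal.ofReal_one, ← ENNReal.ofReal_div_of_pos hc] at this
  refine (measure_mono fun ω hω => ?_).trans this
  exact ENNReal.ofReal_le_ofReal hω

-- A crude second-moment bound suffices: the noise energy is only needed multiplied by the small
-- rounding error of the grid.
omit [IsProbabilityMeasure P] in
lemma IsRun.measure_noise_ge (h : IsRun P σ α g f ℱ ε θ ν x) (hσ : 0 < σ) (n : ℕ) {c : ℝ}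
    (hc : 0 < c) :
    P {ω | c ≤ noise ε n ω ⬝ᵥ noise ε n ω} ≤ ENNReal.ofReal (n * σ ^ 2 / c) := by
  have hmε : ∀ k, Measurable (ε (k + 1)) := fun k => (h.noise_measurable k).mono (ℱ.le _) le_rfl
  have hone : ∀ k, ∫⁻ ω, ENNReal.ofReal (ε (k + 1) ω * ε (k + 1) ω) ∂P = ENNReal.ofReal (σ ^ 2) := by
    intro k
    have hmap := lintegral_map (μ := P) (f := fun e : ℝ => ENNReal.ofReal (e * e)) (by fun_prop)
      (hmε k)
    rw [h.noise_law] at hmap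
    rw [← hmap]
    have hL : MemLp (id : ℝ → ℝ) 2 (gaussianReal 0 (Real.toNNReal (σ ^ 2))) :=
      memLp_id_gaussianReal 2
    have hvar := variance_id_gaussianReal (μ := 0) (v := Real.toNNReal (σ ^ 2))
    rw [variance_of_integral_eq_zero measurable_id.aemeasurable (by simp),
      Real.coe_toNNReal _ (by positivity)] at hvar
    rw [← ofReal_integral_eq_lintegral_ofReal (by simpa [sq] using hL.integrable_sq)
      (ae_of_all _ fun e => mul_self_nonneg e)]
    simp only [id, sq] at hvar ⊢
    rw [hvar]
  have hsum : ∀ ω, ENNReal.ofReal (noise ε n ω ⬝ᵥ noise ε n ω) =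
      ∑ i : Fin n, ENNReal.ofReal (ε (i + 1) ω * ε (i + 1) ω) := by
    intro ω
    rw [dotProduct, ENNReal.ofReal_sum_of_nonneg fun i _ => mul_self_nonneg _]
    rfl
  have hint : ∫⁻ ω, ENNReal.ofReal (noise ε n ω ⬝ᵥ noise ε n ω) ∂P =
      ENNReal.ofReal (n * σ ^ 2) := by
    rw [lintegral_congr hsum, lintegral_finsetSum (f := fun (i : Fin n) ω =>
      ENNReal.ofReal (ε (i + 1) ω * ε (i + 1) ω)) _ fun i _ =>
      ((hmε i).mul (hmε i)).ennreal_ofReal]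
    simp_rw [hone]
    rw [Finset.sum_const, Finset.card_univ, Fintype.card_fin, nsmul_eq_mul,
      ENNReal.ofReal_mul (by positivity), ENNReal.ofReal_natCast]
  have hmeas : Measurable fun ω => ENNReal.ofReal (noise ε n ω ⬝ᵥ noise ε n ω) := by
    rw [funext hsum]
    exact Finset.measurable_sum _ fun i _ => ((hmε i).mul (hmε i)).ennreal_ofReal
  have := meas_ge_le_lintegral_div (μ := P) hmeas.aemeasurable
    (ε := ENNReal.ofReal c) (by simpa using hc) ENNReal.ofReal_ne_top
  rw [hint, ← ENNReal.ofReal_div_of_pos hc] at this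
  refine (measure_mono fun ω hω => ?_).trans this
  exact ENNReal.ofReal_le_ofReal hω

end SelfNormalized

/-! ### Stability in the lengthscales and the grid. -/

section Perturbation

variable {d n : ℕ} {σ α : ℝ}

lemma quad_le_of_abs_le {ι : Type*} [Fintype ι] {A : Matrix ι ι ℝ} {η : ℝ}
    (h : ∀ i j, |A i j| ≤ η) (v : ι → ℝ) :
    v ⬝ᵥ (A *ᵥ v) ≤ Fintype.card ι * η * (v ⬝ᵥ v) := by
  rcases isEmpty_or_nonempty ι with hι | ⟨⟨i₀⟩⟩
  · simp [dotProduct]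
  have hη : 0 ≤ η := (abs_nonneg _).trans (h i₀ i₀)
  calc v ⬝ᵥ (A *ᵥ v) = ∑ i, ∑ j, v i * (A i j * v j) := by
        simp only [dotProduct, Matrix.mulVec, Finset.mul_sum]
    _ ≤ ∑ i, ∑ j, η * (|v i| * |v j|) := by
        refine Finset.sum_le_sum fun i _ => Finset.sum_le_sum fun j _ => ?_
        calc v i * (A i j * v j) ≤ |v i * (A i j * v j)| := le_abs_self _
          _ = |A i j| * (|v i| * |v j|) := by rw [abs_mul, abs_mul]; ring
          _ ≤ _ := by gcongr; exact h i j
    _ = η * (∑ i, |v i|) ^ 2 := by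
        simp_rw [← Finset.mul_sum]
        rw [← Finset.sum_mul, sq]
    _ ≤ η * (Fintype.card ι * ∑ i, |v i| ^ 2) := by
        gcongr
        simpa using sq_sum_le_card_mul_sum_sq (s := Finset.univ) (f := fun i => |v i|)
    _ = _ := by
        simp only [sq_abs]
        simp only [dotProduct, sq]
        ring

/-- An entrywise error `η` changes the quadratic form by at most `n η` times the squared norm, which
a fraction `ρ` of the ridge term dominates. An additive error becomes a relative one without any
lower bound on the spectrum of the kernel matrix. -/
lemma posSemidef_regGram_sub {θ θ' : Fin d → ℝ} {p : Fin n → E d} {η ρ : ℝ} (hρ : 0 ≤ ρ)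
    (h : ∀ i j, |seKernel θ (p i) (p j) - seKernel θ' (p i) (p j)| ≤ η)
    (hη : n * η ≤ ρ * (σ ^ 2 / α)) :
    ((1 + ρ) • regGram σ α θ' p - regGram σ α θ p).PosSemidef := by
  have h1 : ((ρ * (σ ^ 2 / α)) • (1 : Matrix (Fin n) (Fin n) ℝ) -
      (gram θ p - gram θ' p)).PosSemidef := by
    refine .of_dotProduct_mulVec_nonneg ?_ fun v => ?_
    · refine ((Matrix.isHermitian_one).smul (by exact IsSelfAdjoint.all _)).sub
        ((posSemidef_gram θ p).isHermitian.sub (posSemidef_gram θ' p).isHermitian)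
    · have := quad_le_of_abs_le (A := gram θ p - gram θ' p) (η := η) (fun i j => h i j) v
      have hv : 0 ≤ v ⬝ᵥ v := Finset.sum_nonneg fun i _ => mul_self_nonneg _
      rw [Fintype.card_fin] at this
      rw [star_trivial, Matrix.sub_mulVec, dotProduct_sub, Matrix.smul_mulVec, Matrix.one_mulVec,
        dotProduct_smul, smul_eq_mul]
      nlinarith
  have h2 := ((posSemidef_gram θ' p).smul hρ).add h1
  convert! h2 using 1
  simp only [regGram, smul_add, smul_smul, add_smul, add_mul, one_smul, one_mul]
  abel

lemma selfNorm_nonneg (hσ : 0 < σ) (hα : 0 < α) (ℓ : Fin d → ℝ) (p : Fin n → E d)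
    (y : Fin n → ℝ) : 0 ≤ selfNorm σ α ℓ p y := by
  have hc : 0 < σ ^ 2 / α := by positivity
  have h := inv_quad_le (Matrix.PosDef.one (n := Fin n) (R := ℝ)) (posDef_regGram hσ hα ℓ p)
    (inv_pos.2 hc) (by
      have := (posSemidef_gram ℓ p).smul (inv_pos.2 hc).le
      rwa [regGram, smul_add, smul_smul, inv_mul_cancel₀ hc.ne', one_smul, add_sub_cancel_right]) y
  rw [inv_one, Matrix.one_mulVec, ← div_eq_inv_mul, le_div_iff₀ hc] at h
  rw [selfNorm]
  linarith

/-- The relative error passes to the inverse by `inv_quad_le`, and the inverse form times `σ²/α` is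
at most `y ⬝ᵥ y` because `selfNorm` is nonnegative. -/
lemma selfNorm_le_add (hσ : 0 < σ) (hα : 0 < α) {θ θ' : Fin d → ℝ} {p : Fin n → E d} {ρ : ℝ}
    (hρ : 0 ≤ ρ) (h : ((1 + ρ) • regGram σ α θ' p - regGram σ α θ p).PosSemidef) (y : Fin n → ℝ) :
    selfNorm σ α θ p y ≤ ρ * (y ⬝ᵥ y) + selfNorm σ α θ' p y := by
  have hc : 0 < σ ^ 2 / α := by positivity
  have h1 := inv_quad_le (posDef_regGram hσ hα θ p) (posDef_regGram hσ hα θ' p) (by positivity) h y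
  have h2 := selfNorm_nonneg hσ hα θ p y
  have h3 := mul_le_mul_of_nonneg_left h1 hc.le
  rw [selfNorm] at h2 ⊢
  rw [selfNorm]
  have h4 := mul_le_mul_of_nonneg_left (sub_nonneg.1 h2) hρ
  nlinarith

lemma infoGain_le_add (hσ : 0 < σ) (hα : 0 < α) {θ θ' : Fin d → ℝ} {p : Fin n → E d} {ρ : ℝ}
    (hρ : 0 ≤ ρ) (h : ((1 + ρ) • regGram σ α θ' p - regGram σ α θ p).PosSemidef) :
    infoGain σ α θ p ≤ infoGain σ α θ' p + n * ρ / 2 := by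
  have h1 := det_le_pow_mul_det (posDef_regGram hσ hα θ p) (posDef_regGram hσ hα θ' p)
    (by positivity) h
  have h2 := (posDef_regGram hσ hα θ p).det_pos
  have h3 := (posDef_regGram hσ hα θ' p).det_pos
  rw [infoGain, infoGain, det_infoMatrix hσ hα, det_infoMatrix hσ hα]
  have h4 : Real.log ((α / σ ^ 2) ^ n * (regGram σ α θ p).det) ≤
      Real.log ((1 + ρ) ^ n * ((α / σ ^ 2) ^ n * (regGram σ α θ' p).det)) := by
    refine Real.log_le_log (by positivity) ?_
    calc _ ≤ (α / σ ^ 2) ^ n * ((1 + ρ) ^ n * (regGram σ α θ' p).det) := by gcongr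
      _ = _ := by ring
  rw [Real.log_mul (x := (1 + ρ) ^ n) (by positivity) (by positivity), Real.log_pow] at h4
  have h5 : Real.log (1 + ρ) ≤ ρ := by
    have := Real.log_le_sub_one_of_pos (show 0 < 1 + ρ by positivity)
    linarith
  have h6 : (n : ℝ) * Real.log (1 + ρ) ≤ n * ρ := by gcongr
  linarith

lemma abs_exp_neg_sub_exp_neg_le {a b : ℝ} (ha : 0 ≤ a) (hb : 0 ≤ b) :
    |Real.exp (-a) - Real.exp (-b)| ≤ |a - b| := by
  wlog hab : a ≤ b generalizing a b
  · rw [abs_sub_comm, abs_sub_comm a]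
    exact this hb ha (le_of_not_ge hab)
  have h1 : Real.exp (-b) ≤ Real.exp (-a) := Real.exp_le_exp.2 (by linarith)
  rw [abs_of_nonneg (by linarith), abs_of_nonpos (by linarith)]
  have h2 : Real.exp (-b) = Real.exp (-a) * Real.exp (a - b) := by
    rw [← Real.exp_add]; ring_nf
  have h3 := Real.add_one_le_exp (a - b)
  have h4 : Real.exp (-a) ≤ 1 := Real.exp_le_one_iff.2 (by linarith)
  have h5 := Real.exp_pos (-a)
  nlinarith

lemma abs_inv_sq_sub_le {a b c : ℝ} (hc : 0 < c) (ha : c ≤ a) (hb : c ≤ b) :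
    |1 / a ^ 2 - 1 / b ^ 2| ≤ 2 / c ^ 3 * |a - b| := by
  have ha0 : 0 < a := hc.trans_le ha
  have hb0 : 0 < b := hc.trans_le hb
  have h1 : 1 / a ^ 2 - 1 / b ^ 2 = (1 / (a ^ 2 * b) + 1 / (a * b ^ 2)) * (b - a) := by
    field_simp
    ring
  rw [h1, abs_mul, abs_sub_comm b a, abs_of_pos (by positivity)]
  have h2 : 1 / (a ^ 2 * b) ≤ 1 / c ^ 3 := by
    rw [pow_succ c 2]
    gcongr
  have h3 : 1 / (a * b ^ 2) ≤ 1 / c ^ 3 := by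
    rw [pow_succ' c 2]
    gcongr
  have h4 : 2 / c ^ 3 = 1 / c ^ 3 + 1 / c ^ 3 := by ring
  rw [h4]
  gcongr

lemma abs_seKernel_sub_le {θL θ θ' : Fin d → ℝ} (hθL : ∀ i, 0 < θL i) (hθ : ∀ i, θL i ≤ θ i)
    (hθ' : ∀ i, θL i ≤ θ' i) {R : ℝ} {z z' : E d} (hR : ∀ i, (z i - z' i) ^ 2 ≤ R) :
    |seKernel θ z z' - seKernel θ' z z'| ≤ ∑ i, R / θL i ^ 3 * |θ i - θ' i| := by
  have h1 := abs_exp_neg_sub_exp_neg_le (a := 1 / 2 * ∑ i, (z i - z' i) ^ 2 / θ i ^ 2)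
    (b := 1 / 2 * ∑ i, (z i - z' i) ^ 2 / θ' i ^ 2)
    (mul_nonneg (by norm_num) (Finset.sum_nonneg fun i _ => by positivity))
    (mul_nonneg (by norm_num) (Finset.sum_nonneg fun i _ => by positivity))
  rw [seKernel, seKernel, neg_mul, neg_mul]
  refine h1.trans ?_
  rw [← mul_sub, ← Finset.sum_sub_distrib, Finset.mul_sum]
  refine (Finset.abs_sum_le_sum_abs _ _).trans (Finset.sum_le_sum fun i _ => ?_)
  have h2 : 1 / 2 * ((z i - z' i) ^ 2 / θ i ^ 2 - (z i - z' i) ^ 2 / θ' i ^ 2) =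
      1 / 2 * (z i - z' i) ^ 2 * (1 / θ i ^ 2 - 1 / θ' i ^ 2) := by ring
  have h3 := abs_inv_sq_sub_le (hθL i) (hθ i) (hθ' i)
  have h0 := hθL i
  rw [h2, abs_mul, abs_of_nonneg (by positivity)]
  calc 1 / 2 * (z i - z' i) ^ 2 * |1 / θ i ^ 2 - 1 / θ' i ^ 2|
      ≤ 1 / 2 * R * (2 / θL i ^ 3 * |θ i - θ' i|) := by
        gcongr
        · exact mul_nonneg (by norm_num) ((sq_nonneg _).trans (hR i))
        · exact hR i
    _ = _ := by ring

/-- Equidistant grid with `(N + 1) ^ d` nodes in a box. -/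
def gridPoint (θL θU : Fin d → ℝ) (N : ℕ) (j : Fin d → Fin (N + 1)) : Fin d → ℝ :=
  fun i => θL i + (θU i - θL i) * (j i / N)

lemma le_gridPoint {θL θU : Fin d → ℝ} (hLU : ∀ i, θL i ≤ θU i) (N : ℕ)
    (j : Fin d → Fin (N + 1)) (i : Fin d) : θL i ≤ gridPoint θL θU N j i :=
  le_add_of_nonneg_right (mul_nonneg (sub_nonneg.2 (hLU i)) (by positivity))

lemma exists_gridPoint_near {θL θU θ : Fin d → ℝ} (hL : ∀ i, θL i ≤ θ i) (hU : ∀ i, θ i ≤ θU i)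
    {N : ℕ} (hN : 0 < N) :
    ∃ j : Fin d → Fin (N + 1), ∀ i, |θ i - gridPoint θL θU N j i| ≤ (θU i - θL i) / N := by
  have key : ∀ i, ∃ k : Fin (N + 1),
      |θ i - (θL i + (θU i - θL i) * (k / N))| ≤ (θU i - θL i) / N := by
    intro i
    have hN0 : (0 : ℝ) < N := by exact_mod_cast hN
    rcases ((hL i).trans (hU i)).eq_or_lt with h | h
    · refine ⟨0, ?_⟩
      have : θ i = θL i := le_antisymm (h ▸ hU i) (hL i)
      simp [← h, this]
    · have hw : 0 < θU i - θL i := sub_pos.2 h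
      set r := (θ i - θL i) / (θU i - θL i) * N with hr
      have hr0 : 0 ≤ r := mul_nonneg (div_nonneg (sub_nonneg.2 (hL i)) hw.le) hN0.le
      have hrN : r ≤ N := mul_le_of_le_one_left hN0.le
        ((div_le_one hw).2 (by linarith [hU i]))
      refine ⟨⟨⌊r⌋₊, Nat.lt_succ_of_le (Nat.floor_le_of_le hrN)⟩, ?_⟩
      have h1 := Nat.floor_le hr0
      have h2 := Nat.lt_floor_add_one r
      have h3 : θ i - (θL i + (θU i - θL i) * (⌊r⌋₊ / N)) =
          (θU i - θL i) / N * (r - ⌊r⌋₊) := by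
        rw [hr]
        field_simp
        ring
      rw [h3, abs_of_nonneg (mul_nonneg (by positivity) (by linarith))]
      exact mul_le_of_le_one_right (by positivity) (by linarith)
  choose j hj using key
  exact ⟨j, hj⟩

end Perturbation

/-! ### Union bound over rounds and grid points. -/

section Confidence

variable {d : ℕ} {σ α δ : ℝ} {X : Set (E d)}

/-- The logarithmic term in the definition of `mWidth`. -/
def logTerm (δ : ℝ) (t : ℕ) : ℝ := Real.log (2 * (t : ℝ) ^ 2 * Real.pi ^ 2 / (3 * δ))

lemma le_logTerm (hδ : 0 < δ) (n : ℕ) :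
    1 + 2 * Real.log (n + 1) - Real.log δ ≤ logTerm δ (n + 1) := by
  have h1 : 2 * ((n + 1 : ℕ) : ℝ) ^ 2 * Real.pi ^ 2 / (3 * δ) =
      (2 * Real.pi ^ 2 / 3) * ((n : ℝ) + 1) ^ 2 / δ := by
    push_cast
    field_simp
  have hpi := Real.pi_gt_three
  rw [logTerm, h1, Real.log_div (by positivity) hδ.ne', Real.log_mul (by positivity) (by positivity),
    Real.log_pow]
  have h2 : 1 ≤ Real.log (2 * Real.pi ^ 2 / 3) := by
    rw [Real.le_log_iff_exp_le (by positivity)]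
    have := Real.exp_one_lt_d9
    nlinarith
  push_cast
  linarith

lemma mWidth_sq_ge (hσ : 0 < σ) (hα : 0 < α) (hδ : 0 < δ) (hδ1 : δ < 1) (ℓ : Fin d → ℝ) (n : ℕ) :
    α * (maxInfoGain X σ α ℓ n + logTerm δ (n + 1)) ≤ mWidth X σ α δ ℓ (n + 1) ^ 2 := by
  have h0 := maxInfoGain_nonneg (X := X) hσ hα ℓ n
  have h1 := le_logTerm hδ n
  have h2 : 0 ≤ Real.log ((n : ℝ) + 1) := Real.log_nonneg (by linarith [Nat.cast_nonneg (α := ℝ) n])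
  have h3 := Real.log_neg hδ hδ1
  have h4 : 0 ≤ logTerm δ (n + 1) := by linarith
  rw [mWidth, mul_pow, Real.sq_sqrt hα.le, Nat.add_sub_cancel]
  change α * _ ≤ α * (_ + Real.sqrt (logTerm δ (n + 1))) ^ 2
  gcongr
  rw [add_sq, Real.sq_sqrt h0, Real.sq_sqrt h4]
  have : 0 ≤ 2 * Real.sqrt (maxInfoGain X σ α ℓ n) * Real.sqrt (logTerm δ (n + 1)) := by positivity
  linarith

lemma mWidth_nonneg (ℓ : Fin d → ℝ) (t : ℕ) : 0 ≤ mWidth X σ α δ ℓ t := by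
  unfold mWidth
  positivity

/-- The logarithmic term is at least `1` for `δ < 1`. Constants such as the bias bound can therefore
be charged to the width. -/
lemma sqrt_le_mWidth (hσ : 0 < σ) (hα : 0 < α) (hδ : 0 < δ) (hδ1 : δ < 1) (ℓ : Fin d → ℝ) (n : ℕ) :
    Real.sqrt α ≤ mWidth X σ α δ ℓ (n + 1) := by
  refine Real.sqrt_le_iff.2 ⟨mWidth_nonneg _ _, le_trans ?_ (mWidth_sq_ge hσ hα hδ hδ1 ℓ n)⟩
  have h0 := maxInfoGain_nonneg (X := X) hσ hα ℓ n
  have h1 := le_logTerm hδ n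
  have h2 : 0 ≤ Real.log ((n : ℝ) + 1) := Real.log_nonneg (by linarith [Nat.cast_nonneg (α := ℝ) n])
  have h3 := Real.log_neg hδ hδ1
  exact le_mul_of_one_le_right hα.le (by linarith)

lemma exists_sq_sub_le (hX : IsCompact X) :
    ∃ R : ℝ, 0 ≤ R ∧ ∀ z ∈ X, ∀ z' ∈ X, ∀ i, (z i - z' i) ^ 2 ≤ R := by
  obtain ⟨C, hC⟩ := Metric.isBounded_iff.1 hX.isBounded
  refine ⟨C ^ 2, sq_nonneg _, fun z hz z' hz' i => ?_⟩
  have h1 := hC hz hz'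
  have h2 : |z i - z' i| ≤ C := by
    refine le_trans ?_ h1
    rw [dist_eq_norm]
    simpa using PiLp.norm_apply_le (z - z') i
  exact sq_le_sq.2 (h2.trans (le_abs_self C))

/-- Number of grid cells per axis that is used after `n` observations. -/
def gridSize (A n : ℕ) : ℕ := A * (n + 2) ^ 4

/-- Threshold for the likelihood ratios of all grid points after `n` observations. -/
def ratioThreshold (δ : ℝ) (d A n : ℕ) : ℝ :=
  ((gridSize A n + 1 : ℕ) : ℝ) ^ d * (2 * (n + 1) * (n + 2) / δ)

lemma ratioThreshold_pos (hδ : 0 < δ) (d A n : ℕ) : 0 < ratioThreshold δ d A n := by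
  unfold ratioThreshold
  positivity

lemma log_ratioThreshold_le (hδ : 0 < δ) (hδ1 : δ < 1) (d A n : ℕ) :
    Real.log (ratioThreshold δ d A n) ≤ (d * (Real.log (A + 1) + 8) + 6) * logTerm δ (n + 1) := by
  have hn : (0 : ℝ) ≤ n := Nat.cast_nonneg n
  have hA : (0 : ℝ) ≤ A := Nat.cast_nonneg A
  have h1 : Real.log ((gridSize A n + 1 : ℕ) : ℝ) ≤
      Real.log (A + 1) + 4 * Real.log ((n : ℝ) + 2) := by
    have : (4 : ℝ) * Real.log ((n : ℝ) + 2) = Real.log (((n : ℝ) + 2) ^ 4) := by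
      rw [Real.log_pow]; norm_num
    rw [this, ← Real.log_mul (by positivity) (by positivity)]
    refine Real.log_le_log (by positivity) ?_
    rw [gridSize]
    push_cast
    have : 1 ≤ ((n : ℝ) + 2) ^ 4 := one_le_pow₀ (by linarith)
    linarith
  have h2 : Real.log ((n : ℝ) + 2) ≤ 1 + Real.log (n + 1) := by
    have h3 : Real.log ((n : ℝ) + 2) ≤ Real.log (2 * (n + 1)) :=
      Real.log_le_log (by positivity) (by linarith)
    rw [Real.log_mul (by norm_num) (by positivity)] at h3
    have := Real.log_two_lt_d9
    linarith
  have h3 := le_logTerm hδ n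
  have h4 := Real.log_neg hδ hδ1
  have h5 : 0 ≤ Real.log ((n : ℝ) + 1) := Real.log_nonneg (by linarith)
  have h6 : 0 ≤ Real.log ((A : ℝ) + 1) := Real.log_nonneg (by linarith)
  have h7 := Real.log_two_lt_d9
  set L := logTerm δ (n + 1) with hL
  rw [ratioThreshold, Real.log_mul (by positivity) (by positivity), Real.log_pow,
    Real.log_div (by positivity) hδ.ne', Real.log_mul (by positivity) (by positivity),
    Real.log_mul (by positivity) (by positivity)]
  have h8 : Real.log ((gridSize A n + 1 : ℕ) : ℝ) ≤ (Real.log (A + 1) + 8) * L := by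
    have : Real.log (A + 1) ≤ Real.log (A + 1) * L := le_mul_of_one_le_right h6 (by linarith)
    linarith
  have h9 := mul_le_mul_of_nonneg_left h8 (Nat.cast_nonneg (α := ℝ) d)
  linarith

variable {Ω : Type*} {mΩ : MeasurableSpace Ω} {P : Measure Ω} [IsProbabilityMeasure P]
  {g : ℝ} {f : X → ℝ} {ℱ : Filtration ℕ mΩ} {ε : ℕ → Ω → ℝ} {θ : ℕ → Ω → Fin d → ℝ}
  {ν : ℕ → Ω → ℝ} {x : ℕ → Ω → X}

/-- The event that the noise is too large, or fits one of the grid kernels too well, after some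
number of observations. -/
def badEvent (σ α δ : ℝ) (θL θU : Fin d → ℝ) (A : ℕ) (ε : ℕ → Ω → ℝ) (x : ℕ → Ω → X) : Set Ω :=
  ⋃ n : ℕ, {ω | 2 * σ ^ 2 * (n + 1) ^ 2 * (n + 2) / δ ≤ noise ε n ω ⬝ᵥ noise ε n ω} ∪
    ⋃ j : Fin d → Fin (gridSize A n + 1), {ω | ratioThreshold δ d A n ≤
      likelihoodRatio σ α (gridPoint θL θU (gridSize A n) j) (design x n ω) (noise ε n ω)}

/-- Sample size `n` receives the budget `δ / ((n + 1) (n + 2))`, half for the noise energy and half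
for the grid points together; these budgets telescope to at most `δ`. -/
lemma IsRun.measure_badEvent_le (h : IsRun P σ α g f ℱ ε θ ν x) (hσ : 0 < σ) (hα : 0 < α)
    (hδ : 0 < δ) (θL θU : Fin d → ℝ) (A : ℕ) :
    P (badEvent σ α δ θL θU A ε x) ≤ ENNReal.ofReal δ := by
  have hstep : ∀ n : ℕ, P ({ω | 2 * σ ^ 2 * (n + 1) ^ 2 * (n + 2) / δ ≤
        noise ε n ω ⬝ᵥ noise ε n ω} ∪
      ⋃ j : Fin d → Fin (gridSize A n + 1), {ω | ratioThreshold δ d A n ≤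
        likelihoodRatio σ α (gridPoint θL θU (gridSize A n) j) (design x n ω) (noise ε n ω)}) ≤
      ENNReal.ofReal (δ * (1 / (n + 1) - 1 / (n + 2))) := by
    intro n
    have hsplit : δ * (1 / ((n : ℝ) + 1) - 1 / (n + 2)) =
        δ / (2 * (n + 1) * (n + 2)) + δ / (2 * (n + 1) * (n + 2)) := by
      field_simp
      ring
    rw [hsplit, ENNReal.ofReal_add (by positivity) (by positivity)]
    refine (measure_union_le _ _).trans (add_le_add ?_ ?_)
    · refine (h.measure_noise_ge hσ n (by positivity)).trans (ENNReal.ofReal_le_ofReal ?_)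
      rw [div_div_eq_mul_div, div_le_div_iff₀ (by positivity) (by positivity)]
      have : (n : ℝ) ≤ n + 1 := by linarith
      calc (n : ℝ) * σ ^ 2 * δ * (2 * (n + 1) * (n + 2))
          ≤ (n + 1) * σ ^ 2 * δ * (2 * (n + 1) * (n + 2)) := by gcongr
        _ = _ := by ring
    · refine (measure_iUnion_fintype_le _ _).trans ((Finset.sum_le_sum fun j _ =>
        h.measure_likelihoodRatio_ge hσ hα _ n (ratioThreshold_pos hδ d A n)).trans (le_of_eq ?_))
      rw [Finset.sum_const, Finset.card_univ, nsmul_eq_mul, ← ENNReal.ofReal_natCast,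
        ← ENNReal.ofReal_mul (by positivity)]
      congr 1
      rw [Fintype.card_fun, Fintype.card_fin, Fintype.card_fin, ratioThreshold]
      push_cast
      field_simp
  refine (measure_iUnion_le _).trans ((ENNReal.tsum_le_tsum hstep).trans ?_)
  refine ENNReal.tsum_le_of_sum_range_le fun m => ?_
  rw [← ENNReal.ofReal_sum_of_nonneg, ← Finset.mul_sum]
  · refine ENNReal.ofReal_le_ofReal (mul_le_of_le_one_right hδ.le ?_)
    have := Finset.sum_range_sub' (fun n : ℕ => 1 / ((n : ℝ) + 1)) m
    simp only [Nat.cast_add, Nat.cast_one, add_assoc, one_add_one_eq_two] at this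
    rw [this]
    have : 0 ≤ 1 / ((m : ℝ) + 1) := by positivity
    simp
    positivity
  · intro n _
    refine mul_nonneg hδ.le (sub_nonneg.2 ?_)
    gcongr
    norm_num

/-- Round `ℓ` to a grid point, use the likelihood bound there, and return to `ℓ` in the information
gain. Both rounding errors stay bounded in `n`, and the logarithm of the number of grid points is a
multiple of `logTerm`. -/
lemma selfNorm_le_of_notMem_badEvent (hσ : 0 < σ) (hα : 0 < α) (hδ : 0 < δ) (hδ1 : δ < 1)
    {θL θU : Fin d → ℝ} (hθL : ∀ i, 0 < θL i) {R : ℝ}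
    (hR : ∀ z ∈ X, ∀ z' ∈ X, ∀ i, (z i - z' i) ^ 2 ≤ R) {A : ℕ} (hA : 0 < A)
    (hAR : ∑ i, R / θL i ^ 3 * (θU i - θL i) ≤ A * (σ ^ 2 / α)) {ω : Ω}
    (hω : ω ∉ badEvent σ α δ θL θU A ε x) {ℓ : Fin d → ℝ} (hL : ∀ i, θL i ≤ ℓ i)
    (hU : ∀ i, ℓ i ≤ θU i) (n : ℕ) :
    selfNorm σ α ℓ (design x n ω) (noise ε n ω) ≤
      2 * σ ^ 2 * (1 / δ + 1 + (d * (Real.log (A + 1) + 8) + 6)) *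
        (maxInfoGain X σ α ℓ n + logTerm δ (n + 1)) := by
  have hn : (0 : ℝ) ≤ n := Nat.cast_nonneg n
  have hA0 : (0 : ℝ) < A := by exact_mod_cast hA
  have hN : 0 < gridSize A n := by unfold gridSize; positivity
  have hN0 : (0 : ℝ) < gridSize A n := by exact_mod_cast hN
  obtain ⟨j, hj⟩ := exists_gridPoint_near hL hU hN
  set ℓ' := gridPoint θL θU (gridSize A n) j with hℓ'
  have hLℓ' : ∀ i, θL i ≤ ℓ' i := le_gridPoint (fun i => (hL i).trans (hU i)) _ j
  set p := design x n ω with hp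
  set y := noise ε n ω with hy
  have hpX : ∀ i, p i ∈ X := fun i => (x (i + 1) ω).2
  -- The cubic decay beats the noise threshold, which grows like `n ^ 3`, and the loss `n ρ / 2` in
  -- the information gain; the fourth power in `gridSize` gives it, one factor being spent on the
  -- matrix size.
  set ρ : ℝ := 1 / ((n : ℝ) + 2) ^ 3 with hρ
  have hρ0 : 0 ≤ ρ := by positivity
  have hclose : ∀ i k, |seKernel ℓ (p i) (p k) - seKernel ℓ' (p i) (p k)| ≤
      A * (σ ^ 2 / α) / gridSize A n := by
    intro i k
    refine (abs_seKernel_sub_le hθL hL hLℓ' (hR _ (hpX i) _ (hpX k))).trans ?_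
    refine le_trans (Finset.sum_le_sum fun i' _ => mul_le_mul_of_nonneg_left (hj i') ?_)
      (le_trans (le_of_eq ?_) (div_le_div_of_nonneg_right hAR hN0.le))
    · exact div_nonneg ((sq_nonneg _).trans (hR _ (hpX i) _ (hpX k) i')) (pow_pos (hθL i') 3).le
    · rw [Finset.sum_div]
      exact Finset.sum_congr rfl fun i' _ => by ring
  have hη : n * (A * (σ ^ 2 / α) / gridSize A n) ≤ ρ * (σ ^ 2 / α) := by
    have : (n : ℝ) * (A * (σ ^ 2 / α) / gridSize A n) = n / (n + 2) ^ 4 * (σ ^ 2 / α) := by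
      rw [gridSize]
      push_cast
      field_simp
    rw [this, hρ]
    refine mul_le_mul_of_nonneg_right ?_ (by positivity)
    rw [div_le_div_iff₀ (by positivity) (by positivity), one_mul, pow_succ' ((n : ℝ) + 2) 3]
    gcongr
    linarith
  have hsub := posSemidef_regGram_sub hρ0 hclose hη
  have hsub' := posSemidef_regGram_sub (θ := ℓ') (θ' := ℓ) hρ0
    (fun i k => by rw [abs_sub_comm]; exact hclose i k) hη
  have h1 := selfNorm_le_add hσ hα hρ0 hsub y
  have h2 := infoGain_le_add hσ hα hρ0 hsub'
  have h3 : infoGain σ α ℓ p ≤ maxInfoGain X σ α ℓ n :=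
    infoGain_le_maxInfoGain hσ hα ℓ fun i : Fin n => x (i + 1) ω
  simp only [badEvent, Set.mem_iUnion, Set.mem_union, Set.mem_ofPred_eq, not_exists, not_or,
    not_le] at hω
  obtain ⟨h4, h5⟩ := hω n
  replace h5 := h5 j
  rw [← hℓ', ← hp, ← hy] at h5
  rw [← hy] at h4
  have h6 : selfNorm σ α ℓ' p y ≤ 2 * σ ^ 2 * (infoGain σ α ℓ' p +
      Real.log (ratioThreshold δ d A n)) := by
    rw [likelihoodRatio, ← Real.lt_log_iff_exp_lt (ratioThreshold_pos hδ d A n), sub_lt_iff_lt_add,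
      div_lt_iff₀ (by positivity)] at h5
    linarith
  have h7 := log_ratioThreshold_le hδ hδ1 d A n
  have h8 : ρ * (y ⬝ᵥ y) ≤ 2 * σ ^ 2 * (1 / δ) := by
    calc ρ * (y ⬝ᵥ y) ≤ ρ * (2 * σ ^ 2 * (n + 1) ^ 2 * (n + 2) / δ) := by gcongr
      _ = 2 * σ ^ 2 * (1 / δ) * ((n + 1) ^ 2 / (n + 2) ^ 2) := by
        rw [hρ]
        field_simp
      _ ≤ _ := by
        refine mul_le_of_le_one_right (by positivity) ?_
        rw [div_le_one (by positivity)]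
        gcongr
        norm_num
  have h9 : n * ρ / 2 ≤ 1 := by
    rw [hρ, mul_one_div, div_div, div_le_one (by positivity)]
    have : 1 ≤ ((n : ℝ) + 2) ^ 2 := one_le_pow₀ (by linarith)
    nlinarith
  have hlt := le_logTerm hδ n
  have hlog1 : 0 ≤ Real.log ((n : ℝ) + 1) := Real.log_nonneg (by linarith)
  have hlogδ := Real.log_neg hδ hδ1
  set Lt := logTerm δ (n + 1)
  have hLt : 1 ≤ Lt := by linarith
  set D : ℝ := d * (Real.log (A + 1) + 8) + 6 with hD
  have hD0 : 0 ≤ D := by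
    have : 0 ≤ Real.log ((A : ℝ) + 1) := Real.log_nonneg (by linarith)
    positivity
  have hG := maxInfoGain_nonneg (X := X) hσ hα ℓ n
  set G := maxInfoGain X σ α ℓ n
  have hδi : 0 < 1 / δ := by positivity
  have hfin : 1 / δ + (G + 1 + D * Lt) ≤ (1 / δ + 1 + D) * (G + Lt) := by
    have : 0 ≤ (1 / δ + D) * G := by positivity
    have : 1 / δ ≤ 1 / δ * Lt := le_mul_of_one_le_right hδi.le hLt
    nlinarith
  calc _ ≤ 2 * σ ^ 2 * (1 / δ) + 2 * σ ^ 2 * (G + 1 + D * Lt) := by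
        refine h1.trans (add_le_add h8 (h6.trans ?_))
        gcongr
        linarith
    _ = 2 * σ ^ 2 * (1 / δ + (G + 1 + D * Lt)) := by ring
    _ ≤ 2 * σ ^ 2 * ((1 / δ + 1 + D) * (G + Lt)) := by gcongr
    _ = _ := by ring

end Confidence

/-! ### From confidence bands to the regret of a round, and variance sums. -/

section Regret

variable {d n : ℕ} {σ α δ : ℝ} {X : Set (E d)}

lemma noise_regression_le_mWidth (hσ : 0 < σ) (hα : 0 < α) (hδ : 0 < δ) (hδ1 : δ < 1)
    {ℓ : Fin d → ℝ} {p : Fin n → E d} {y : Fin n → ℝ} {D : ℝ} (hD : 0 ≤ D)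
    (h : selfNorm σ α ℓ p y ≤ 2 * σ ^ 2 * D * (maxInfoGain X σ α ℓ n + logTerm δ (n + 1)))
    (z : E d) :
    |postMean σ α ℓ p y z| ≤
      Real.sqrt (2 * D) * mWidth X σ α δ ℓ (n + 1) * postStd σ α ℓ p z := by
  have hpv := postVar_pos hσ hα ℓ p z
  have hm := mWidth_sq_ge (X := X) hσ hα hδ hδ1 ℓ n
  have h1 := noise_regression_le hσ hα ℓ p y z
  refine abs_le_of_sq_le_sq ?_ (mul_nonneg (mul_nonneg (Real.sqrt_nonneg _) (mWidth_nonneg _ _))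
    (Real.sqrt_nonneg _))
  rw [postStd, mul_pow, mul_pow, Real.sq_sqrt (by positivity), Real.sq_sqrt hpv.le]
  refine h1.trans ?_
  change postVar σ α ℓ p z * (selfNorm σ α ℓ p y / (σ ^ 2 / α)) ≤ _
  rw [mul_comm (2 * D * _)]
  gcongr
  rw [div_le_iff₀ (by positivity)]
  refine h.trans ?_
  calc 2 * σ ^ 2 * D * (maxInfoGain X σ α ℓ n + logTerm δ (n + 1))
      = 2 * D * (α * (maxInfoGain X σ α ℓ n + logTerm δ (n + 1))) * (σ ^ 2 / α) := by
        field_simp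
    _ ≤ _ := by gcongr

/-- Confidence bands that hold simultaneously for all rounds and all admissible lengthscales. -/
lemma exists_confidence_width (hX : IsCompact X) (hσ : 0 < σ) (hα : 0 < α) (hδ : 0 < δ)
    (hδ1 : δ < 1) {θL θU : Fin d → ℝ} (hθL : ∀ i, 0 < θL i) (hLU : ∀ i, θL i ≤ θU i) (B : ℝ) :
    ∃ M : ℝ, 0 < M ∧ ∀ (H : Type*) [NormedAddCommGroup H] [InnerProductSpace ℝ H] [CompleteSpace H]
      [RKHS ℝ H X ℝ] (_ : ∀ z z' : X, RKHS.kernel H z z' (1 : ℝ) = seKernel θU z z')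
      (f : H) (_ : ‖f‖ ≤ B) (Ω : Type*) (mΩ : MeasurableSpace Ω) (P : Measure Ω)
      (_ : IsProbabilityMeasure P) (g : ℝ) (ℱ : Filtration ℕ mΩ) (ε : ℕ → Ω → ℝ)
      (θ : ℕ → Ω → Fin d → ℝ) (ν : ℕ → Ω → ℝ) (x : ℕ → Ω → X) (_ : IsRun P σ α g f ℱ ε θ ν x),
      ∃ S : Set Ω, P S ≤ ENNReal.ofReal δ ∧ ∀ ω ∉ S, ∀ (n : ℕ) (ℓ : Fin d → ℝ)
        (_ : ∀ i, θL i ≤ ℓ i) (_ : ∀ i, ℓ i ≤ θU i) (z : X),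
        |f z - postMean σ α ℓ (design x n ω) (observations f ε x n ω) z| ≤
          M * mWidth X σ α δ ℓ (n + 1) * postStd σ α ℓ (design x n ω) z := by
  obtain ⟨R, hR0, hR⟩ := exists_sq_sub_le hX
  -- With `A` cells per axis, rounding the lengthscales moves a kernel value by at most `σ²/α`.
  obtain ⟨A, hA⟩ := exists_nat_gt ((∑ i, R / θL i ^ 3 * (θU i - θL i)) / (σ ^ 2 / α))
  have hA0 : 0 < A := by
    have : 0 ≤ (∑ i, R / θL i ^ 3 * (θU i - θL i)) / (σ ^ 2 / α) :=
      div_nonneg (Finset.sum_nonneg fun i _ =>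
        mul_nonneg (div_nonneg hR0 (pow_pos (hθL i) 3).le) (sub_nonneg.2 (hLU i))) (by positivity)
    exact_mod_cast this.trans_lt hA
  have hAR : ∑ i, R / θL i ^ 3 * (θU i - θL i) ≤ A * (σ ^ 2 / α) :=
    ((div_lt_iff₀ (by positivity)).1 hA).le
  set D : ℝ := 1 / δ + 1 + (d * (Real.log (A + 1) + 8) + 6) with hD
  have hlog : 0 ≤ Real.log ((A : ℝ) + 1) := Real.log_nonneg (by simp)
  have hD0 : 0 < D := by positivity
  -- The first summand serves the noise; the second is the bias bound, divided by `√α ≤ mWidth`.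
  refine ⟨Real.sqrt (2 * D) + Real.sqrt (lengthscaleRatio θL θU) * |B| / Real.sqrt α,
    by positivity, ?_⟩
  intro H _ _ _ _ hk f hf Ω mΩ P _ g ℱ ε θ ν x hrun
  refine ⟨badEvent σ α δ θL θU A ε x, hrun.measure_badEvent_le hσ hα hδ θL θU A, ?_⟩
  intro ω hω n ℓ hL hU z
  have h1 := noise_regression_le_mWidth (X := X) hσ hα hδ hδ1 hD0.le
    (selfNorm_le_of_notMem_badEvent hσ hα hδ hδ1 hθL hR hA0 hAR hω hL hU n) z
  have h2 := regression_bias_le hσ hα hθL hL hU hk f (fun i : Fin n => x (i + 1) ω) z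
  have h3 : postMean σ α ℓ (design x n ω) (observations f ε x n ω) z =
      postMean σ α ℓ (design x n ω) (fun i => f (x (i + 1) ω)) z +
        postMean σ α ℓ (design x n ω) (noise ε n ω) z := postMean_add _ _ _ _ _
  have hs := sqrt_le_mWidth (X := X) hσ hα hδ hδ1 ℓ n
  have hsα : 0 < Real.sqrt α := Real.sqrt_pos.2 hα
  have hstd : 0 ≤ postStd σ α ℓ (design x n ω) z := Real.sqrt_nonneg _
  have h4 : Real.sqrt (lengthscaleRatio θL θU) * ‖f‖ ≤
      Real.sqrt (lengthscaleRatio θL θU) * |B| / Real.sqrt α * mWidth X σ α δ ℓ (n + 1) := by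
    rw [div_mul_eq_mul_div, le_div_iff₀ hsα]
    have := hf.trans (le_abs_self B)
    gcongr
  rw [h3, ← sub_sub]
  refine (abs_sub _ _).trans ?_
  rw [add_mul, add_mul, add_comm]
  refine add_le_add h1 (h2.trans ?_)
  exact mul_le_mul_of_nonneg_right h4 hstd

lemma exists_maxPostMean_eq [Nonempty X] (hX : IsCompact X) (ℓ : Fin d → ℝ) (p : Fin n → E d)
    (y : Fin n → ℝ) : ∃ z₀ : X, maxPostMean X σ α ℓ p y = postMean σ α ℓ p y z₀ ∧
      ∀ z : X, postMean σ α ℓ p y z ≤ maxPostMean X σ α ℓ p y := by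
  have hcont : Continuous fun z : X => postMean σ α ℓ p y z := by
    unfold postMean
    exact (continuous_pi fun i => continuous_seKernel ℓ continuous_const
      continuous_subtype_val).dotProduct continuous_const
  have := isCompact_iff_compactSpace.1 hX
  obtain ⟨z₀, -, hz₀⟩ := isCompact_univ.exists_isMaxOn Set.univ_nonempty hcont.continuousOn
  have hle : ∀ z : X, postMean σ α ℓ p y z ≤ postMean σ α ℓ p y z₀ := fun z => hz₀ (Set.mem_univ z)
  have heq : maxPostMean X σ α ℓ p y = postMean σ α ℓ p y z₀ :=
    le_antisymm (ciSup_le hle)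
      (le_ciSup (f := fun z : X => postMean σ α ℓ p y z) ⟨_, by rintro _ ⟨z, rfl⟩; exact hle z⟩ z₀)
  exact ⟨z₀, heq, fun z => heq ▸ hle z⟩

/-- For `v ≤ c` monotonicity gives `τ_1(v) ≥ τ_1(c)`; beyond `c` the left side is not positive.
Using `τ_1` instead of `τ_g` makes the factor independent of `g`. -/
lemma sub_le_div_tau_mul {c v : ℝ} (hc : 0 < c) (hv : 0 ≤ v) :
    c - v ≤ c / tau 1 c * tau 1 v := by
  have h1 := tau_pos le_rfl c
  have h2 := tau_pos le_rfl v
  rcases le_total v c with h | h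
  · have h3 := (strictAnti_tau (le_refl (1 : ℝ))).antitone h
    calc c - v ≤ c := by linarith
      _ = c / tau 1 c * tau 1 c := by field_simp
      _ ≤ _ := by gcongr
  · have : 0 ≤ c / tau 1 c * tau 1 v := by positivity
    linarith

lemma Cg_pos {g : ℝ} (hg : 1 ≤ g) : 0 < Cg g := tau_zero hg ▸ tau_pos hg 0

lemma tau_one_zero_le {g : ℝ} (hg : 1 ≤ g) : tau 1 0 ≤ Cg g ^ (1 / g) := by
  have h := tau_one_rpow_le hg 0
  rw [tau_zero hg] at h
  have h2 := Real.rpow_le_rpow (Real.rpow_nonneg (tau_pos le_rfl 0).le _) h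
    (show 0 ≤ 1 / g by positivity)
  rwa [← Real.rpow_mul (tau_pos le_rfl 0).le, mul_one_div_cancel (by linarith), Real.rpow_one] at h2

lemma tauInv_nonneg (hσ : 0 < σ) (hα : 0 < α) {g : ℝ} (hg : 1 ≤ g) {r : ℝ} (hr : 0 ≤ r) :
    0 ≤ tauInv g (Cg g * (σ ^ 2 / (α * r + σ ^ 2)) ^ (g / 2)) := by
  have hCg := Cg_pos hg
  refine le_tauInv hg (by positivity) ?_
  rw [tau_zero hg]
  refine mul_le_of_le_one_right hCg.le (Real.rpow_le_one (by positivity) ?_ (by positivity))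
  rw [div_le_one (by positivity)]
  have : 0 ≤ α * r := by positivity
  linarith

/-- Regret of a maximizer of the acquisition function, given confidence bands of width `φ`. -/
lemma regret_le (hX : IsCompact X) (hσ : 0 < σ) (hα : 0 < α) {g : ℝ} (hg : 1 ≤ g) {f : X → ℝ}
    {ℓ : Fin d → ℝ} {p : Fin n → E d} {y : Fin n → ℝ} {ν φ c : ℝ} (hν : 0 < ν) (hc : 0 < c)
    (hφ : φ / ν ≤ c)
    (hf : ∀ z : X, |f z - postMean σ α ℓ p y z| ≤ φ * postStd σ α ℓ p z) (w xstar : X)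
    (hw : ∀ z : X, acquisition X σ α g ν ℓ p y z ≤ acquisition X σ α g ν ℓ p y w) :
    f xstar - f w ≤ postStd σ α ℓ p w * (φ + ν * (c / tau 1 c) * Cg g ^ (1 / g) +
      ν * tauInv g (Cg g * (σ ^ 2 / (α * n + σ ^ 2)) ^ (g / 2))) := by
  have hg0 : 0 < g := by linarith
  have : Nonempty X := ⟨w⟩
  obtain ⟨z₀, hz₀, hmax⟩ := exists_maxPostMean_eq (σ := σ) (α := α) hX ℓ p y
  set μ := maxPostMean X σ α ℓ p y with hμ
  have hstd : ∀ z : X, 0 < postStd σ α ℓ p z := fun z => Real.sqrt_pos.2 (postVar_pos hσ hα ℓ p z)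
  have hCg := Cg_pos hg
  set s := postStd σ α ℓ p w with hs
  set sx := postStd σ α ℓ p xstar with hsx
  have hs0 : 0 < s := hstd w
  have hsx0 : 0 < sx := hstd xstar
  set v := (μ - postMean σ α ℓ p y w) / s / ν with hv
  set vx := (μ - postMean σ α ℓ p y xstar) / sx / ν with hvx
  have hv0 : 0 ≤ v := div_nonneg (div_nonneg (sub_nonneg.2 (hmax w)) hs0.le) hν.le
  have hvx0 : 0 ≤ vx := div_nonneg (div_nonneg (sub_nonneg.2 (hmax xstar)) hsx0.le) hν.le
  have hvs : μ - postMean σ α ℓ p y w = ν * s * v := by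
    rw [hv]; field_simp
  have hvxs : μ - postMean σ α ℓ p y xstar = ν * sx * vx := by
    rw [hvx]; field_simp
  have hνg : 0 < ν ^ g := Real.rpow_pos_of_pos hν g
  have hacqw : acquisition X σ α g ν ℓ p y w = ν ^ g * (s ^ g * tau g v) := by
    rw [acquisition, mul_assoc]
  -- Optimality of `w` against `xstar`, after the power mean inequality and a `g`-th root.
  have h1 : sx * tau 1 vx ≤ s * Cg g ^ (1 / g) := by
    have h := hw xstar
    rw [hacqw, acquisition, mul_assoc] at h
    have h' : sx ^ g * tau g vx ≤ s ^ g * tau g v := le_of_mul_le_mul_left h hνg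
    have hvC : tau g v ≤ Cg g := tau_zero hg ▸ (strictAnti_tau hg).antitone hv0
    have h2 : (sx * tau 1 vx) ^ g ≤ (s * Cg g ^ (1 / g)) ^ g := by
      rw [Real.mul_rpow hsx0.le (tau_pos le_rfl _).le, Real.mul_rpow hs0.le (by positivity),
        ← Real.rpow_mul hCg.le, one_div_mul_cancel hg0.ne', Real.rpow_one]
      calc sx ^ g * tau 1 vx ^ g ≤ sx ^ g * tau g vx := by
            gcongr
            exact tau_one_rpow_le hg vx
        _ ≤ s ^ g * tau g v := h'
        _ ≤ _ := by gcongr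
    exact (Real.rpow_le_rpow_iff (mul_nonneg hsx0.le (tau_pos le_rfl _).le) (by positivity) hg0).1 h2
  -- Optimality of `w` against the maximizer `z₀` of the posterior mean, where the argument of `τ_g`
  -- is zero; the variance at `z₀` is bounded below by `le_postVar` and the one at `w` above by `1`.
  have h2 : v ≤ tauInv g (Cg g * (σ ^ 2 / (α * n + σ ^ 2)) ^ (g / 2)) := by
    refine le_tauInv hg (by positivity) ?_
    have h := hw z₀
    rw [hacqw, acquisition, mul_assoc, ← hμ, hz₀, sub_self, zero_div, zero_div, tau_zero hg] at h
    have h' := le_of_mul_le_mul_left h hνg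
    have hs1 : s ^ g ≤ 1 := Real.rpow_le_one hs0.le
      (Real.sqrt_le_one.2 (postVar_le_one hσ hα ℓ p w)) hg0.le
    have hlow : (σ ^ 2 / (α * n + σ ^ 2)) ^ (g / 2) ≤ postStd σ α ℓ p z₀ ^ g := by
      have hb : 0 ≤ σ ^ 2 / (α * n + σ ^ 2) := by positivity
      rw [show g / 2 = (1 / 2) * g by ring, Real.rpow_mul hb, ← Real.sqrt_eq_rpow, postStd]
      exact Real.rpow_le_rpow (Real.sqrt_nonneg _) (Real.sqrt_le_sqrt (le_postVar hσ hα ℓ p z₀))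
        hg0.le
    calc Cg g * (σ ^ 2 / (α * n + σ ^ 2)) ^ (g / 2)
        ≤ Cg g * postStd σ α ℓ p z₀ ^ g := by gcongr
      _ = postStd σ α ℓ p z₀ ^ g * Cg g := mul_comm _ _
      _ ≤ s ^ g * tau g v := h'
      _ ≤ tau g v := mul_le_of_le_one_left (tau_pos hg v).le hs1
  have h3 := (abs_le.1 (hf xstar)).2
  have h4 := (abs_le.1 (hf w)).1
  -- The possible advantage of `xstar` over the best posterior mean, turned into a multiple of the
  -- standard deviation at `w`.
  have h5 : φ * sx - ν * sx * vx ≤ ν * (c / tau 1 c) * (s * Cg g ^ (1 / g)) := by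
    have h6 : φ ≤ c * ν := (div_le_iff₀ hν).1 hφ
    have hcτ : 0 < c / tau 1 c := div_pos hc (tau_pos le_rfl c)
    calc φ * sx - ν * sx * vx ≤ c * ν * sx - ν * sx * vx := by gcongr
      _ = ν * sx * (c - vx) := by ring
      _ ≤ ν * sx * (c / tau 1 c * tau 1 vx) := by
        gcongr
        exact sub_le_div_tau_mul hc hvx0
      _ = ν * (c / tau 1 c) * (sx * tau 1 vx) := by ring
      _ ≤ _ := by gcongr
  have h7 : ν * s * v ≤ ν * s * tauInv g (Cg g * (σ ^ 2 / (α * n + σ ^ 2)) ^ (g / 2)) := by gcongr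
  rw [← hs] at h4
  rw [← hsx] at h3
  linarith

lemma sum_Icc_one_eq_sum_range (F : ℕ → ℝ) (T : ℕ) :
    ∑ t ∈ Finset.Icc 1 T, F t = ∑ t ∈ Finset.range T, F (t + 1) := by
  induction T with
  | zero => simp
  | succ T ih => rw [Finset.sum_Icc_succ_top (by omega), ih, Finset.sum_range_succ]

lemma sum_postStd_le (hσ : 0 < σ) (hα : 0 < α) (hα1 : α ≤ 1) (ℓ : Fin d → ℝ) (q : ℕ → X)
    (T : ℕ) :
    ∑ t ∈ Finset.range T, postStd σ α ℓ (fun i : Fin t => (q i : E d)) (q t) ≤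
      Real.sqrt (2 / Real.log (1 + 1 / σ ^ 2)) *
        Real.sqrt (maxInfoGain X σ α ℓ T * T / α) := by
  have hlog : 0 < Real.log (1 + 1 / σ ^ 2) := Real.log_pos (by
    have : 0 < 1 / σ ^ 2 := by positivity
    linarith)
  have h1 := sum_postVar_le hσ hα hα1 ℓ (fun i => (q i : E d)) T
  have h2 : infoGain σ α ℓ (fun i : Fin T => (q i : E d)) ≤ maxInfoGain X σ α ℓ T :=
    infoGain_le_maxInfoGain hσ hα ℓ fun i : Fin T => q i
  rw [← Real.sqrt_mul (by positivity)]
  refine Real.le_sqrt_of_sq_le ?_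
  have h3 := sq_sum_le_card_mul_sum_sq (s := Finset.range T)
    (f := fun t => postStd σ α ℓ (fun i : Fin t => (q i : E d)) (q t))
  have h4 : ∀ t, postStd σ α ℓ (fun i : Fin t => (q i : E d)) (q t) ^ 2 =
      postVar σ α ℓ (fun i : Fin t => (q i : E d)) (q t) := fun t =>
    Real.sq_sqrt (postVar_pos hσ hα ℓ _ _).le
  simp_rw [h4] at h3
  rw [Finset.card_range] at h3
  calc _ ≤ (T : ℝ) * ∑ t ∈ Finset.range T, postVar σ α ℓ (fun i : Fin t => (q i : E d)) (q t) := h3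
    _ ≤ T * (2 / (α * Real.log (1 + 1 / σ ^ 2)) * maxInfoGain X σ α ℓ T) := by
      gcongr
      refine h1.trans ?_
      gcongr
    _ = _ := by
      field_simp

end Regret

end TemperedBO

end

/-! ### The regret bound. -/

open TemperedBO

theorem mainTheorem1 (σ : ℝ) (hσ : 0 < σ) :
    ∃ K : ℝ, 0 < K ∧
    ∀ (d : ℕ) (X : Set (TemperedBO.E d)) (_ : IsCompact X)
      (θL θU : Fin d → ℝ) (_ : ∀ i, 0 < θL i) (_ : ∀ i, θL i ≤ θU i)
      (α δ C₁ B : ℝ) (_ : 0 < α) (_ : α ≤ 1) (_ : 0 < δ) (_ : 0 < C₁),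
    ∃ C₃ : ℝ, 0 < C₃ ∧
    ∀ (g : ℝ) (_ : 1 ≤ g),
      (StrictAnti (TemperedBO.tau g) ∧ Set.range (TemperedBO.tau g) = Set.Ioi 0) ∧
      ∀ (H : Type*) [NormedAddCommGroup H] [InnerProductSpace ℝ H] [CompleteSpace H]
        [RKHS ℝ H X ℝ]
        (_ : ∀ z z' : X, RKHS.kernel H z z' (1 : ℝ) = TemperedBO.seKernel θU z z')
        (f : H) (_ : ‖f‖ ≤ B) (xstar : X) (_ : ∀ z : X, f z ≤ f xstar)
        (Ω : Type*) (mΩ : MeasurableSpace Ω) (P : Measure Ω) (_ : IsProbabilityMeasure P)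
        (ℱ : Filtration ℕ mΩ) (ε : ℕ → Ω → ℝ) (θ : ℕ → Ω → Fin d → ℝ) (ν : ℕ → Ω → ℝ)
        (x : ℕ → Ω → X)
        (_ : TemperedBO.IsRun P σ α g f ℱ ε θ ν x)
        (_ : ∀ t ω, 1 ≤ t → ∀ i, θL i ≤ θ t ω i ∧ θ t ω i ≤ θU i)
        (_ : ∀ t ω, 1 ≤ t → 0 < ν t ω ∧
          |TemperedBO.mWidth X σ α δ (θ t ω) t / ν t ω| ≤ C₁ ∧
          ν t ω ≤ C₁ * TemperedBO.mWidth X σ α δ (θ t ω) t),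
        ENNReal.ofReal (1 - δ) ≤
          P {ω | ∀ T : ℕ, 1 ≤ T →
            TemperedBO.cumRegret f xstar x T ω ≤
              K * (TemperedBO.betaRate X σ α δ g C₁ C₃ θL θU ‖f‖ T *
                Real.sqrt (TemperedBO.maxInfoGain X σ α θL T * T / α))} := by
  have hlogσ : 0 < Real.log (1 + 1 / σ ^ 2) := Real.log_pos (by
    have : 0 < 1 / σ ^ 2 := by positivity
    linarith)
  refine ⟨Real.sqrt (2 / Real.log (1 + 1 / σ ^ 2)), by positivity, ?_⟩
  intro d X hX θL θU hθL hLU α δ C₁ B hα hα1 hδ hC₁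
  -- For `δ ≥ 1` the claimed probability is at most zero.
  rcases le_or_gt 1 δ with hδ1 | hδ1
  · refine ⟨1, one_pos, fun g hg => ⟨⟨strictAnti_tau hg, range_tau hg⟩, ?_⟩⟩
    intros
    rw [ENNReal.ofReal_of_nonpos (by linarith)]
    exact zero_le
  obtain ⟨M, hM, hconf⟩ := exists_confidence_width hX hσ hα hδ hδ1 hθL hLU B
  set c := C₁ * M with hc
  have hc0 : 0 < c := mul_pos hC₁ hM
  have hτ0 : 0 < tau 1 0 := tau_pos le_rfl 0
  have hcτ : 0 < c / tau 1 c := div_pos hc0 (tau_pos le_rfl c)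
  -- The first summand pays for the band width at the query, since `τ_1(0) ≤ C_(g) ^ (1/g)`; the
  -- second is the factor from `regret_le`. Neither involves `g`.
  refine ⟨M / (C₁ * tau 1 0) + c / tau 1 c, by positivity, fun g hg =>
    ⟨⟨strictAnti_tau hg, range_tau hg⟩, ?_⟩⟩
  intro H _ _ _ _ hk f hf xstar _ Ω mΩ P _ ℱ ε θ ν x hrun hθ hν
  obtain ⟨S, hPS, hS⟩ := hconf H hk f hf Ω mΩ P inferInstance g ℱ ε θ ν x hrun
  refine le_trans ?_ (measure_mono (s := Sᶜ) fun ω hω => ?_)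
  -- Subadditivity suffices, so no measurability of `S` or of the regret event is needed.
  · have h1 : (1 : ENNReal) ≤ P Sᶜ + P S := by
      rw [← measure_univ (μ := P), ← Set.compl_union_self S]
      exact measure_union_le _ _
    rw [ENNReal.ofReal_sub _ hδ.le, ENNReal.ofReal_one]
    exact tsub_le_iff_right.2 (h1.trans (add_le_add le_rfl hPS))
  intro T hT
  have : Nonempty X := ⟨xstar⟩
  have hCg := Cg_pos hg
  set m := mWidth X σ α δ θL T with hm
  have hm0 : 0 ≤ m := mWidth_nonneg _ _
  set I := tauInv g (Cg g * (σ ^ 2 / (α * ((T : ℝ) - 1) + σ ^ 2)) ^ (g / 2)) with hI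
  have hT1 : (0 : ℝ) ≤ (T : ℝ) - 1 := sub_nonneg.2 (by exact_mod_cast hT)
  have hI0 : 0 ≤ I := tauInv_nonneg hσ hα hg hT1
  set β := betaRate X σ α δ g C₁ (M / (C₁ * tau 1 0) + c / tau 1 c) θL θU ‖f‖ T with hβ
  -- The norm term and the `2√2` term of `β` are nonnegative slack: `M` already accounts for bias
  -- and noise.
  have hβge : (C₁ * (M / (C₁ * tau 1 0) + c / tau 1 c) * Cg g ^ (1 / g) + C₁ * I) * m ≤ β := by
    have h1 : 0 ≤ Real.sqrt (2 * lengthscaleRatio θL θU) * ‖f‖ := by positivity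
    have h2 : 0 ≤ 2 * Real.sqrt 2 * m := by positivity
    rw [hβ, betaRate]
    linarith
  have hβ0 : 0 ≤ β := le_trans (by positivity) hβge
  have hround : ∀ n < T, f xstar - f (x (n + 1) ω) ≤
      β * postStd σ α θL (design x n ω) (x (n + 1) ω) := by
    intro n hn
    obtain ⟨hν0, hν1, hν2⟩ := hν (n + 1) ω (by omega)
    have hL := fun i => (hθ (n + 1) ω (by omega) i).1
    have hU := fun i => (hθ (n + 1) ω (by omega) i).2
    set ℓ := θ (n + 1) ω with hℓ
    have hmm : mWidth X σ α δ ℓ (n + 1) ≤ m :=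
      mWidth_le_mWidth hσ hα hδ hθL hL (by omega) hn
    have hφ : M * mWidth X σ α δ ℓ (n + 1) / ν (n + 1) ω ≤ c := by
      rw [mul_div_assoc, hc, mul_comm C₁]
      exact mul_le_mul_of_nonneg_left ((le_abs_self _).trans hν1) hM.le
    have h1 := regret_le hX hσ hα hg hν0 hc0 hφ (hS ω hω n ℓ hL hU) (x (n + 1) ω) xstar
      (hrun.query_max n ω)
    have hνm : ν (n + 1) ω ≤ C₁ * m := hν2.trans (by gcongr)
    -- Round `n + 1 ≤ T` has seen `n ≤ T - 1` observations, whence the `T - 1` in the rate.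
    have hIn : tauInv g (Cg g * (σ ^ 2 / (α * n + σ ^ 2)) ^ (g / 2)) ≤ I := by
      refine tauInv_anti hg (by positivity) ?_
      have : (n : ℝ) ≤ (T : ℝ) - 1 := by
        rw [le_sub_iff_add_le]
        exact_mod_cast hn
      gcongr
    have hCg1 := tau_one_zero_le hg
    have hbr : M * mWidth X σ α δ ℓ (n + 1) + ν (n + 1) ω * (c / tau 1 c) * Cg g ^ (1 / g) +
        ν (n + 1) ω * tauInv g (Cg g * (σ ^ 2 / (α * n + σ ^ 2)) ^ (g / 2)) ≤ β := by
      refine le_trans ?_ hβge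
      have h2 : M * mWidth X σ α δ ℓ (n + 1) ≤ C₁ * (M / (C₁ * tau 1 0)) * Cg g ^ (1 / g) * m := by
        calc M * mWidth X σ α δ ℓ (n + 1) ≤ M * m := by gcongr
          _ = C₁ * (M / (C₁ * tau 1 0)) * tau 1 0 * m := by field_simp
          _ ≤ _ := by gcongr
      have h3 : ν (n + 1) ω * (c / tau 1 c) * Cg g ^ (1 / g) ≤
          C₁ * m * (c / tau 1 c) * Cg g ^ (1 / g) := by gcongr
      have h4 : ν (n + 1) ω * tauInv g (Cg g * (σ ^ 2 / (α * n + σ ^ 2)) ^ (g / 2)) ≤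
          C₁ * m * I := mul_le_mul hνm hIn
            (tauInv_nonneg hσ hα hg (Nat.cast_nonneg n)) (by positivity)
      linarith
    have hstd0 : 0 ≤ postStd σ α ℓ (design x n ω) (x (n + 1) ω) := Real.sqrt_nonneg _
    refine h1.trans ?_
    rw [mul_comm β]
    calc _ ≤ postStd σ α ℓ (design x n ω) (x (n + 1) ω) * β := by gcongr
      _ ≤ _ := by
        -- Passing to the fixed lengthscales `θL` puts all rounds under one kernel, as the
        -- information gain sum requires.
        refine mul_le_mul_of_nonneg_right ?_ hβ0
        exact Real.sqrt_le_sqrt (postVar_anti hσ hα hθL hL _ _)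
  rw [cumRegret, sum_Icc_one_eq_sum_range]
  have hsum := sum_postStd_le (X := X) hσ hα hα1 θL (fun i => x (i + 1) ω) T
  calc ∑ t ∈ Finset.range T, (f xstar - f (x (t + 1) ω))
      ≤ ∑ t ∈ Finset.range T, β * postStd σ α θL (design x t ω) (x (t + 1) ω) :=
        Finset.sum_le_sum fun t ht => hround t (Finset.mem_range.1 ht)
    _ = β * ∑ t ∈ Finset.range T, postStd σ α θL (design x t ω) (x (t + 1) ω) := by
        rw [Finset.mul_sum]
    _ ≤ β * (Real.sqrt (2 / Real.log (1 + 1 / σ ^ 2)) *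
          Real.sqrt (maxInfoGain X σ α θL T * T / α)) := mul_le_mul_of_nonneg_left hsum hβ0
    _ = _ := by ring
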